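/- All graphs are finite, simple and non-empty. **Search trees and rotations.** A search tree on a connected graph $G$ is a rooted tree $T$ with vertex set $V(G)$, defined recursively: its root is a vertex $r\in V(G)$, and the children of $r$ are the roots of search trees on the connected components of $G-r$. Write $d_{T,u}$ for the distance in $T$ from the root to $u$, and $T|u$ for the subtree of $T$ rooted in $u$ (consisting of the descendants of $u$); if $u$ is the parent of $w$, then $T|w$ is called a subtree of $u$. If $b$ is a child of $a$ in $T$, the $ab$-rotation makes $b$ take the place of $a$ (as the root, or as a child of the parent of $a$) and makes $a$ a child of $b$; the other subtrees of $a$ remain subtrees of $a$; a subtree $S$ of $b$ becomes a subtree of $a$ if $a$ is adjacent in $G$ to a vertex of $S$, and remains a subtree of $b$ otherwise. The rotation graph $\mathcal R(G)$ has the search trees on $G$ as vertices, two being adjacent if they differ by one rotation. **Insertions.** Let $G$ be a connected graph, $K\subseteq V(G)$ a non-empty clique, $x\notin V(G)$, and let $G_K$ be obtained from $G$ by adding the vertex $x$ with neighbourhood $K$. For a search tree $T$ on $G$ let $\lambda(T)=\max\{d_{T,u} : u\in K\}$, let $v_{\lambda(T)}$ be the (unique) vertex of $K$ of level $\lambda(T)$,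 and let $a_0,\dots,a_{\lambda(T)}=v_{\lambda(T)}$ be the path $A$ in $T$ from the root to $v_{\lambda(T)}$. For $0\le i\le\lambda(T)+1$ let $T(i)$ be the rooted tree on $V(G)\cup\{x\}$ obtained from $T$ by placing $x$ above the root, as the new root, if $i=0$; by subdividing the edge $a_{i-1}a_i$ with $x$ if $1\le i\le\lambda(T)$; and by adding $x$ as a new child of $v_{\lambda(T)}$ if $i=\lambda(T)+1$. Put $P^x(T)=\{T(i) : 0\le i\le \lambda(T)+1\}$. **The sets $\varepsilon^x(e)$.** Let $T'$ be obtained from $T$ by an $ab$-rotation, with $a$ the parent of $b$ in $T$, and let $k=\lambda(T)$ and $l=d_{T,b}$. The following pairs are said to be described by the rotation. 1. If $a,b\notin A$: $T(i),T'(i)$ for $0\le i\le k+1$. 2. If $a,b\in A$ and $b\ne v_{\lambda(T)}$, let $S$ be the subtree of $b$ that contains $v_{\lambda(T)}$. - If some vertex of $S$ is adjacent to $a$ in $G$: $T(i),T'(i)$ for $0\le i\le k+1$, $i\neq l$. - If no vertex of $S$ is adjacent to $a$ in $G$: $T(i),T'(i)$ for $0\le i\le l-1$, and $T(i+1),T'(i)$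 for $l\le i\le k$. 3. If $b=v_{\lambda(T)}$: $T(i),T'(i)$ for $0\le i\le k-1$, together with $T(k+1),T'(k+1)$ if $a\in K$, and $T(k+1),T'(k)$ if $a\notin K$. (In the remaining case $a\in A$, $b\notin A$ the inverse rotation, from $T'$ to $T$, falls under 2 or 3.) For an edge $e=TT'$ of $\mathcal R(G)$, let $\varepsilon^x(e)$ be the set of the unordered pairs described by the rotations from $T$ to $T'$ or from $T'$ to $T$. **Proposition.** Let $G$ be a connected graph and $K\subseteq V(G)$ a non-empty clique. Then: 1. Every $T(i)$ with $T\in V(\mathcal R(G))$ and $0\le i\le\lambda(T)+1$ is a search tree on $G_K$, the sets $P^x(T)$ for different $T$ are different, and $\{P^x(T) : T\in V(\mathcal R(G))\}$ is a partition of $V(\mathcal R(G_K))$. 2. For every $T\in V(\mathcal R(G))$, the set $P^x(T)$ induces in $\mathcal R(G_K)$ the path $T(0),T(1),\dots,T(\lambda(T)+1)$ with $\lambda(T)+2$ vertices. 3. For every edge $e=TT'$ of $\mathcal R(G)$, $\varepsilon^x(e)$ is exactly the set of edges of $\mathcal R(G_K)$ with one endpoint in $P^x(T)$ and the other in $P^x(T')$;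 and $$E(\mathcal R(G_K))=\Big(\bigcup_{T\in V(\mathcal R(G))}E(P^x(T))\Big)\cup\Big(\bigcup_{e\in E(\mathcal R(G))}\varepsilon^x(e)\Big),$$ where $E(P^x(T))$ is the set of the edges $T(i)T(i+1)$, $0\le i\le\lambda(T)$. -/

import Mathlib

/-- A rooted tree with vertex set `V`, given by its root and its parent map.  By convention the
parent of the root is the root itself; every vertex reaches the root by going up. -/
@[ext]
structure RootedTreeOn (V : Type*) where
  root : V
  parent : V → V
  parent_root : parent root = root
  exists_iterate : ∀ v, ∃ n : ℕ, parent^[n] v = root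

namespace RootedTreeOn

variable {V : Type*} (T : RootedTreeOn V)

/-- `w` is a child of `u` in `T`. -/
def IsChild (w u : V) : Prop := w ≠ T.root ∧ T.parent w = u

/-- `u` lies on the path from the root to `v`, that is, `v` is a vertex of the subtree `T|u`. -/
def IsAncestor (u v : V) : Prop := ∃ n : ℕ, T.parent^[n] v = u

open scoped Classical in
/-- The level `d_{T,v}` of `v`: its distance from the root. -/
noncomputable def depth (v : V) : ℕ := Nat.find (T.exists_iterate v)

/-- The vertex in level `j` of the path from the root to `v` (for `j ≤ T.depth v`). -/
noncomputable def pathVertex (v : V) (j : ℕ) : V := T.parent^[T.depth v - j] v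

theorem iterate_depth (v : V) : T.parent^[T.depth v] v = T.root := by
  classical
  exact Nat.find_spec (T.exists_iterate v)

theorem depth_le_of_iterate {v : V} {n : ℕ} (h : T.parent^[n] v = T.root) : T.depth v ≤ n := by
  classical
  exact Nat.find_min' (T.exists_iterate v) h

theorem depth_iterate (v : V) (m : ℕ) : T.depth (T.parent^[m] v) = T.depth v - m := by
  apply le_antisymm
  · apply T.depth_le_of_iterate
    rw [← Function.iterate_add_apply]
    have hfix : ∀ n, T.parent^[n] T.root = T.root :=
      fun n => Function.iterate_fixed T.parent_root n
    have h : T.depth v - m + m = (T.depth v - m + m - T.depth v) + T.depth v := by omega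
    rw [h, Function.iterate_add_apply, T.iterate_depth, hfix]
  · have h := T.iterate_depth (T.parent^[m] v)
    rw [← Function.iterate_add_apply] at h
    have := T.depth_le_of_iterate h
    omega

theorem depth_pathVertex (v : V) {j : ℕ} (hj : j ≤ T.depth v) :
    T.depth (T.pathVertex v j) = j := by
  rw [pathVertex, depth_iterate]
  omega

theorem depth_root : T.depth T.root = 0 :=
  Nat.le_zero.mp (T.depth_le_of_iterate (n := 0) rfl)

theorem eq_root_of_depth_eq_zero {v : V} (h : T.depth v = 0) : v = T.root := by
  have := T.iterate_depth v
  rwa [h] at this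

open scoped Classical in
/-- The parent map of the insertion `T(i,x,v)`, where the new vertex `x` is `none`. -/
noncomputable def insertParent (i : ℕ) (v : V) : Option V → Option V
  | none => if i = 0 then none else some (T.pathVertex v (i - 1))
  | some w => if i ≤ T.depth v ∧ w = T.pathVertex v i then none else some (T.parent w)

/-- The root of the insertion `T(i,x,v)`. -/
def insertRoot (i : ℕ) : Option V := if i = 0 then none else some T.root

theorem insertParent_root (i : ℕ) (v : V) :
    T.insertParent i v (T.insertRoot i) = T.insertRoot i := by
  by_cases hi : i = 0
  · simp [insertRoot, insertParent, hi]
  · have h : ¬ (i ≤ T.depth v ∧ T.root = T.pathVertex v i) := by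
      rintro ⟨h1, h2⟩
      have := T.depth_pathVertex v h1
      rw [← h2, T.depth_root] at this
      omega
    simp [insertRoot, insertParent, hi, h, T.parent_root]

theorem insert_exists_iterate (i : ℕ) (v : V) (y : Option V) :
    ∃ n : ℕ, (T.insertParent i v)^[n] y = T.insertRoot i := by
  classical
  have step : ∀ y, (∃ n : ℕ, (T.insertParent i v)^[n] (T.insertParent i v y) = T.insertRoot i) →
      ∃ n : ℕ, (T.insertParent i v)^[n] y = T.insertRoot i := by
    rintro y ⟨n, hn⟩
    exact ⟨n + 1, by rwa [Function.iterate_succ_apply]⟩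
  have key : ∀ (d : ℕ) (w : V), T.depth w = d →
      ∃ n : ℕ, (T.insertParent i v)^[n] (some w) = T.insertRoot i := by
    intro d
    induction d using Nat.strong_induction_on with
    | _ d ih =>
      intro w hw
      by_cases hc : i ≤ T.depth v ∧ w = T.pathVertex v i
      · have hd := T.depth_pathVertex v hc.1
        rw [← hc.2, hw] at hd
        have h1 : T.insertParent i v (some w) = none := by
          simp only [insertParent]; rw [if_pos hc]
        apply step
        rw [h1]
        by_cases hi : i = 0
        · exact ⟨0, by simp [insertRoot, hi]⟩
        · apply step
          have h2 : T.insertParent i v none = some (T.pathVertex v (i - 1)) := by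
            simp [insertParent, hi]
          rw [h2]
          exact ih (i - 1) (by omega) _ (T.depth_pathVertex v (by omega))
      · by_cases h0 : d = 0
        · have hr : w = T.root := T.eq_root_of_depth_eq_zero (hw.trans h0)
          by_cases hi : i = 0
          · exfalso
            apply hc
            refine ⟨by omega, ?_⟩
            rw [hi, pathVertex, Nat.sub_zero, T.iterate_depth, hr]
          · exact ⟨0, by simp [insertRoot, hi, hr]⟩
        · have h1 : T.insertParent i v (some w) = some (T.parent w) := by
            simp only [insertParent]; rw [if_neg hc]
          apply step
          rw [h1]
          have := T.depth_iterate w 1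
          rw [Function.iterate_one] at this
          exact ih (d - 1) (by omega) _ (by omega)
  cases y with
  | some w => exact key _ w rfl
  | none =>
    by_cases hi : i = 0
    · exact ⟨0, by simp [insertRoot, hi]⟩
    · apply step
      have h2 : T.insertParent i v none = some (T.pathVertex v (i - 1)) := by
        simp [insertParent, hi]
      rw [h2]
      exact key _ _ rfl

/-- The insertion `T(i,x,v)` (for `i ≤ T.depth v + 1`) of the new vertex `x = none` along the path
from the root to `v`, whose vertices are `a_0, …, a_d`: for `i = 0` the vertex `x` is put above the
root, for `1 ≤ i ≤ d` it subdivides the edge `a_{i-1} a_i`, and for `i = d + 1` it becomes a new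
child of `v = a_d`. -/
noncomputable def insertAt (i : ℕ) (v : V) : RootedTreeOn (Option V) where
  root := T.insertRoot i
  parent := T.insertParent i v
  parent_root := T.insertParent_root i v
  exists_iterate := T.insert_exists_iterate i v

open scoped Classical in
/-- `T'` is produced from `T` by the `uv`-rotation with respect to the graph `G`, where `v` is a
child of `u` in `T`. -/
structure IsRotation (G : SimpleGraph V) (T : RootedTreeOn V) (u v : V) (T' : RootedTreeOn V) :
    Prop where
  isChild : T.IsChild v u
  /-- `v` takes the place of `u`: it becomes the root or a child of the parent of `u`. -/
  root_eq : T'.root = if u = T.root then v else T.root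
  parent_v : u ≠ T.root → T'.parent v = T.parent u
  isChild_u : T'.IsChild u v
  /-- The other subtrees of `u` stay subtrees of `u`. -/
  child_u : ∀ w, T.IsChild w u → w ≠ v → T'.parent w = u
  /-- The subtrees of `v` with a vertex adjacent to `u` become subtrees of `u`, and the others
  stay subtrees of `v`. -/
  child_v : ∀ w, T.IsChild w v →
    T'.parent w = if ∃ z, T.IsAncestor w z ∧ G.Adj u z then u else v
  /-- Nothing else changes. -/
  parent_other : ∀ w, w ≠ u → w ≠ v → T.parent w ≠ u → T.parent w ≠ v →
    T'.parent w = T.parent w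

end RootedTreeOn

/-- `C` is the vertex set of a connected component of the subgraph of `G` induced by `S`. -/
def IsComponentOf {V : Type*} (G : SimpleGraph V) (S C : Set V) : Prop :=
  ∃ c : (G.induce S).ConnectedComponent, C = Subtype.val '' c.supp

/-- The part `T|r` of `T` is a search tree with root `r` on the subgraph of `G` induced by `S`:
the children of `r` are the roots `f C` of search trees on the connected components `C` of
`G[S] - r`. -/
inductive IsSearchTreeOn {V : Type*} (G : SimpleGraph V) (T : RootedTreeOn V) : Set V → V → Prop
  | mk (S : Set V) (r : V) (hr : r ∈ S) (f : Set V → V)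
      (children : ∀ w, T.IsChild w r ↔ ∃ C, IsComponentOf G (S \ {r}) C ∧ w = f C)
      (subtrees : ∀ C, IsComponentOf G (S \ {r}) C → IsSearchTreeOn G T C (f C)) :
      IsSearchTreeOn G T S r

/-- `T` is a search tree on the (connected) graph `G`. -/
def IsSearchTree {V : Type*} (G : SimpleGraph V) (T : RootedTreeOn V) : Prop :=
  IsSearchTreeOn G T Set.univ T.root

/-- The search trees on `G`. -/
abbrev SearchTree {V : Type*} (G : SimpleGraph V) := {T : RootedTreeOn V // IsSearchTree G T}

/-- The rotation graph `R(G)`: search trees are adjacent if they differ by one rotation. -/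
def rotationGraph {V : Type*} (G : SimpleGraph V) : SimpleGraph (SearchTree G) :=
  SimpleGraph.fromRel fun T T' => ∃ u v, RootedTreeOn.IsRotation G T.1 u v T'.1

/-- The graph `G_K` obtained from `G` by adding a new vertex `x = none` with neighbourhood `K`. -/
def addSimplicial {V : Type*} (G : SimpleGraph V) (K : Finset V) : SimpleGraph (Option V) where
  Adj
    | some u, some v => G.Adj u v
    | some u, none => u ∈ K
    | none, some v => v ∈ K
    | none, none => False
  symm := ⟨by rintro (_ | u) (_ | v) h <;> first | exact h | exact G.adj_symm h⟩
  loopless := ⟨by rintro (_ | u) h <;> first | exact h | exact G.irrefl h⟩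

namespace RootedTreeOn

variable {V : Type*} (T : RootedTreeOn V)

/-- `λ(T)`, the maximal level of a vertex of `K` in `T`. -/
noncomputable def maxLevel (K : Finset V) : ℕ := K.sup T.depth

/-- `v_{λ(T)}`, a vertex of `K` of maximal level in `T` (there is only one when `T` is a search
tree on `G` and `K` is a clique of `G`). -/
noncomputable def lowest (K : Finset V) (hK : K.Nonempty) : V :=
  (K.exists_max_image T.depth hK).choose

/-- `T(i) = T(i, x, v_{λ(T)})`, for `0 ≤ i ≤ λ(T) + 1`. -/
noncomputable def insertLowest (K : Finset V) (hK : K.Nonempty) (i : ℕ) : RootedTreeOn (Option V) :=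
  T.insertAt i (T.lowest K hK)

/-- Let `T'` be obtained from `T` by the `ab`-rotation, where `a` is the parent of `b` in `T`, let
`A` be the path from the root of `T` to `v_{λ(T)}`, `k = λ(T)`, and let `l` be the level of `b`.
`EpsIndex G K hK T a b i j` says that the pair `T(i), T'(j)` is one of the pairs that this rotation
describes.  No pair is listed for `a ∈ A`, `b ∉ A`: there the inverse rotation, from `T'` to `T`,
falls under one of the cases. -/
inductive EpsIndex (G : SimpleGraph V) (K : Finset V) (hK : K.Nonempty) (T : RootedTreeOn V)
    (a b : V) : ℕ → ℕ → Prop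
  /-- `a, b ∉ A`: the pairs `T(i), T'(i)` for `0 ≤ i ≤ k + 1`. -/
  | off_path (i : ℕ) (ha : ¬ T.IsAncestor a (T.lowest K hK))
      (hb : ¬ T.IsAncestor b (T.lowest K hK)) (hi : i ≤ T.maxLevel K + 1) :
      EpsIndex G K hK T a b i i
  /-- `a, b ∈ A`, `b ≠ v_{λ(T)}`, and the subtree of `b` that contains `v_{λ(T)}` has a vertex
  adjacent to `a`: the pairs `T(i), T'(i)` for `0 ≤ i ≤ k + 1`, `i ≠ l`. -/
  | on_path_adj (i : ℕ) (ha : T.IsAncestor a (T.lowest K hK))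
      (hb : T.IsAncestor b (T.lowest K hK)) (hne : b ≠ T.lowest K hK)
      (hS : ∃ c, T.IsChild c b ∧ T.IsAncestor c (T.lowest K hK) ∧
        ∃ z, T.IsAncestor c z ∧ G.Adj a z)
      (hi : i ≤ T.maxLevel K + 1) (hil : i ≠ T.depth b) : EpsIndex G K hK T a b i i
  /-- `a, b ∈ A`, `b ≠ v_{λ(T)}`, and the subtree of `b` that contains `v_{λ(T)}` has no vertex
  adjacent to `a`: the pairs `T(i), T'(i)` for `0 ≤ i ≤ l - 1` … -/
  | on_path_not_adj_above (i : ℕ) (ha : T.IsAncestor a (T.lowest K hK))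
      (hb : T.IsAncestor b (T.lowest K hK)) (hne : b ≠ T.lowest K hK)
      (hS : ¬ ∃ c, T.IsChild c b ∧ T.IsAncestor c (T.lowest K hK) ∧
        ∃ z, T.IsAncestor c z ∧ G.Adj a z)
      (hi : i < T.depth b) : EpsIndex G K hK T a b i i
  /-- … and the pairs `T(i+1), T'(i)` for `l ≤ i ≤ k`. -/
  | on_path_not_adj_below (i : ℕ) (ha : T.IsAncestor a (T.lowest K hK))
      (hb : T.IsAncestor b (T.lowest K hK)) (hne : b ≠ T.lowest K hK)
      (hS : ¬ ∃ c, T.IsChild c b ∧ T.IsAncestor c (T.lowest K hK) ∧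
        ∃ z, T.IsAncestor c z ∧ G.Adj a z)
      (hi : T.depth b ≤ i) (hik : i ≤ T.maxLevel K) : EpsIndex G K hK T a b (i + 1) i
  /-- `b = v_{λ(T)}`, whether `a ∈ K` or not: the pairs `T(i), T'(i)` for `0 ≤ i ≤ k - 1` … -/
  | lowest_above (i : ℕ) (hb : b = T.lowest K hK) (hi : i < T.maxLevel K) :
      EpsIndex G K hK T a b i i
  /-- … together with the pair `T(k+1), T'(k+1)` when `a ∈ K` … -/
  | lowest_mem (hb : b = T.lowest K hK) (ha : a ∈ K) :
      EpsIndex G K hK T a b (T.maxLevel K + 1) (T.maxLevel K + 1)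
  /-- … and the pair `T(k+1), T'(k)` when `a ∉ K`. -/
  | lowest_not_mem (hb : b = T.lowest K hK) (ha : a ∉ K) :
      EpsIndex G K hK T a b (T.maxLevel K + 1) (T.maxLevel K)

end RootedTreeOn

section Blocks

variable {V : Type*} {G : SimpleGraph V} (K : Finset V) (hK : K.Nonempty)

/-- The set `P^x(T) = {T(i) : 0 ≤ i ≤ λ(T) + 1}` of search trees on `G_K`. -/
def insertionBlock (T : SearchTree G) : Set (SearchTree (addSimplicial G K)) :=
  {R | ∃ i ≤ T.1.maxLevel K + 1, R.1 = T.1.insertLowest K hK i}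

/-- The edges `T(i) T(i+1)`, `0 ≤ i ≤ λ(T)`, of the path `P^x(T)`. -/
def blockPathEdges (T : SearchTree G) : Set (Sym2 (SearchTree (addSimplicial G K))) :=
  {f | ∃ i ≤ T.1.maxLevel K, ∃ R R' : SearchTree (addSimplicial G K),
    R.1 = T.1.insertLowest K hK i ∧ R'.1 = T.1.insertLowest K hK (i + 1) ∧ f = s(R, R')}

/-- The set `ε^x(e)`: the pairs described by the rotations, in both directions, between the two
endpoints of the edge `e` of `R(G)`. -/
def epsilonEdges (e : Sym2 (SearchTree G)) : Set (Sym2 (SearchTree (addSimplicial G K))) :=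
  {f | ∃ (T T' : SearchTree G) (a b : V) (i j : ℕ) (R R' : SearchTree (addSimplicial G K)),
    e = s(T, T') ∧ RootedTreeOn.IsRotation G T.1 a b T'.1 ∧
      RootedTreeOn.EpsIndex G K hK T.1 a b i j ∧
      R.1 = T.1.insertLowest K hK i ∧ R'.1 = T'.1.insertLowest K hK j ∧ f = s(R, R')}

end Blocks

/-! Everything is read off the ancestor order, which determines a rooted tree
(`eq_of_isAncestor_iff`). On a connected graph, search trees are the rooted trees in which adjacent
vertices are comparable and the parent of each non-root vertex c is adjacent to a vertex of the
subtree at c (`isSearchTree_iff`). Two of them differ by an ab-rotation exactly when a lies above b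
in one, b lies above a in the other, and every third vertex has the same descendants in both
(`isRotation_iff`).

In a search tree on G_K the subtree of each child of x meets K. The vertices of K are pairwise
comparable, so x has at most one child, and restricting the order to V gives a search tree T on G.
The place of x is recorded by its child c, or by x being a leaf, and the position of K on the path A
forces x onto A or directly below its end. This gives the partition
(`IsElimTree.exists_eq_insertAbove`, `eq_of_insertLowest_eq`).

A rotation in R(G_K) that involves x keeps T and moves x by one step (`IsFlip.eq_of_none`). A
rotation of two old vertices a, b restricts to a rotation from T to T' and keeps the set of vertices
below x, so T(i) together with a, b and T' determines T'(j). It remains to see that all listed pairs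
are rotations (`EpsIndex.isFlip`), that every i is listed except the slot between a and b
(`exists_epsIndex`), and that this slot admits no such rotation (`IsFlip.epsIndex`). The shifts in
the indices come from counting strict ancestors before and after the rotation. -/

namespace RootedTreeOn

/-! ### The ancestor order of a rooted tree -/

variable {V : Type*} {T T' : RootedTreeOn V} {u v w z : V}

theorem IsAncestor.refl (T : RootedTreeOn V) (u : V) : T.IsAncestor u u := ⟨0, rfl⟩

theorem IsAncestor.trans (h : T.IsAncestor u v) (h' : T.IsAncestor v w) : T.IsAncestor u w := by
  obtain ⟨m, rfl⟩ := h
  obtain ⟨n, rfl⟩ := h'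
  exact ⟨m + n, Function.iterate_add_apply _ _ _ _⟩

theorem isAncestor_parent (T : RootedTreeOn V) (v : V) : T.IsAncestor (T.parent v) v := ⟨1, rfl⟩

theorem root_isAncestor (T : RootedTreeOn V) (v : V) : T.IsAncestor T.root v :=
  ⟨T.depth v, T.iterate_depth v⟩

theorem isAncestor_total (h : T.IsAncestor u w) (h' : T.IsAncestor v w) :
    T.IsAncestor u v ∨ T.IsAncestor v u := by
  obtain ⟨m, rfl⟩ := h
  obtain ⟨n, rfl⟩ := h'
  rcases le_total m n with h | h
  · right
    refine ⟨n - m, ?_⟩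
    rw [← Function.iterate_add_apply]
    congr 2
    omega
  · left
    refine ⟨m - n, ?_⟩
    rw [← Function.iterate_add_apply]
    congr 2
    omega

theorem IsAncestor.depth_le (h : T.IsAncestor u v) : T.depth u ≤ T.depth v := by
  obtain ⟨m, rfl⟩ := h
  rw [depth_iterate]
  omega

theorem IsAncestor.eq_of_depth_le (h : T.IsAncestor u v) (hd : T.depth v ≤ T.depth u) : u = v := by
  obtain ⟨m, rfl⟩ := h
  rw [depth_iterate] at hd
  by_cases hm : m = 0
  · simp [hm]
  · have h0 : T.depth v = 0 := by omega
    rw [T.eq_root_of_depth_eq_zero h0]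
    exact Function.iterate_fixed T.parent_root m

theorem IsAncestor.antisymm (h : T.IsAncestor u v) (h' : T.IsAncestor v u) : u = v :=
  h.eq_of_depth_le h'.depth_le

theorem isAncestor_root_iff : T.IsAncestor u T.root ↔ u = T.root :=
  ⟨fun h => h.antisymm (T.root_isAncestor u), fun h => h ▸ IsAncestor.refl T u⟩

theorem IsAncestor.isAncestor_parent (h : T.IsAncestor u v) (hne : u ≠ v) :
    T.IsAncestor u (T.parent v) := by
  obtain ⟨m, rfl⟩ := h
  cases m with
  | zero => exact absurd rfl hne
  | succ m => exact ⟨m, (Function.iterate_succ_apply _ _ _).symm⟩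

theorem parent_ne (h : v ≠ T.root) : T.parent v ≠ v := by
  intro hp
  apply h
  rw [← T.iterate_depth v]
  exact (Function.iterate_fixed hp _).symm

theorem isAncestor_iff_parent (hne : v ≠ T.root) :
    T.IsAncestor u v ↔ u = v ∨ T.IsAncestor u (T.parent v) := by
  constructor
  · intro h
    by_cases huv : u = v
    · exact Or.inl huv
    · exact Or.inr (h.isAncestor_parent huv)
  · rintro (rfl | h)
    · exact IsAncestor.refl T u
    · exact h.trans (T.isAncestor_parent v)

theorem isAncestor_iff_step : T.IsAncestor w z ↔
    z = w ∨ (z ≠ T.root ∧ T.IsAncestor w (T.parent z)) := by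
  by_cases hz : z = T.root
  · simp [hz, isAncestor_root_iff, eq_comm]
  · rw [isAncestor_iff_parent hz]
    simp [hz, eq_comm]

theorem not_isAncestor_parent (h : v ≠ T.root) : ¬ T.IsAncestor v (T.parent v) := fun h' =>
  parent_ne h ((T.isAncestor_parent v).antisymm h')

theorem ne_root_of_isAncestor (h : T.IsAncestor u v) (hne : u ≠ v) : v ≠ T.root := by
  rintro rfl
  exact hne (isAncestor_root_iff.1 h)

/-- The parent is the lowest strict ancestor; this turns order information back into parent maps. -/
theorem parent_eq (h : T.IsAncestor u v) (hne : u ≠ v)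
    (hmax : ∀ w, T.IsAncestor w v → w ≠ v → T.IsAncestor w u) : T.parent v = u :=
  (hmax _ (T.isAncestor_parent v) (parent_ne (ne_root_of_isAncestor h hne))).antisymm
    (h.isAncestor_parent hne)

theorem depth_parent (h : v ≠ T.root) : T.depth (T.parent v) + 1 = T.depth v := by
  have h1 := T.depth_iterate v 1
  rw [Function.iterate_one] at h1
  have : T.depth v ≠ 0 := fun h0 => h (T.eq_root_of_depth_eq_zero h0)
  omega

theorem IsChild.isAncestor (h : T.IsChild w u) : T.IsAncestor u w :=
  h.2 ▸ T.isAncestor_parent w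

theorem IsChild.ne (h : T.IsChild w u) : u ≠ w := h.2 ▸ parent_ne h.1

theorem IsChild.depth_eq (h : T.IsChild w u) : T.depth w = T.depth u + 1 := by
  rw [← depth_parent h.1, h.2]

theorem IsChild.isAncestor_of_ne (h : T.IsChild w u) (hv : T.IsAncestor v w) (hne : v ≠ w) :
    T.IsAncestor v u := h.2 ▸ hv.isAncestor_parent hne

/-- The first vertex after `u` on the path from `u` down to `z`. -/
theorem exists_isChild (h : T.IsAncestor u z) (hne : u ≠ z) :
    ∃ c, T.IsChild c u ∧ T.IsAncestor c z := by
  obtain ⟨m, hm⟩ := h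
  induction m generalizing z with
  | zero => exact absurd hm.symm hne
  | succ m ih =>
    have hz : z ≠ T.root := ne_root_of_isAncestor ⟨m + 1, hm⟩ hne
    by_cases hp : u = T.parent z
    · exact ⟨z, ⟨hz, hp.symm⟩, IsAncestor.refl T z⟩
    · obtain ⟨c, hc, hcz⟩ := ih hp (by rwa [Function.iterate_succ_apply] at hm)
      exact ⟨c, hc, hcz.trans (T.isAncestor_parent z)⟩

theorem eq_of_isAncestor_iff (h : ∀ u v, T.IsAncestor u v ↔ T'.IsAncestor u v) : T = T' := by
  have hroot : T.root = T'.root :=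
    isAncestor_root_iff.1 ((h _ _).1 (T.root_isAncestor _))
  ext v
  · exact hroot
  · by_cases hv : v = T.root
    · rw [hv, T.parent_root, hroot, T'.parent_root]
    · apply parent_eq
      · exact (h _ _).2 (T'.isAncestor_parent v)
      · exact parent_ne (hroot ▸ hv)
      · intro w hw hne
        exact (h _ _).2 (((h _ _).1 hw).isAncestor_parent hne)

/-- The descendants of u obey a recursion along the parent map, and induction on the level shows
that the recursion has one solution. The ancestor order of a tree given by its parent map can thus
be guessed and checked one step at a time. -/
theorem isAncestor_iff_of_step {P : V → Prop}
    (h : ∀ z, P z ↔ z = u ∨ (z ≠ T.root ∧ P (T.parent z))) (z : V) : T.IsAncestor u z ↔ P z := by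
  induction hd : T.depth z using Nat.strong_induction_on generalizing z with
  | _ d ih =>
    by_cases hz : z = T.root
    · rw [h z, hz, isAncestor_root_iff]
      simp [eq_comm]
    · rw [h z, isAncestor_iff_parent hz, ih _ (by have := depth_parent hz; omega) _ rfl]
      simp [hz, eq_comm]

/-- Makes levels comparable between different trees: only the sets of strict ancestors have to be
compared. -/
theorem depth_eq_ncard [Finite V] (T : RootedTreeOn V) (z : V) :
    T.depth z = {w | T.IsAncestor w z ∧ w ≠ z}.ncard := by
  induction hd : T.depth z generalizing z with
  | zero =>
    rw [T.eq_root_of_depth_eq_zero hd]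
    symm
    rw [Set.ncard_eq_zero]
    ext w
    simp [isAncestor_root_iff]
  | succ d ih =>
    have hz : z ≠ T.root := by
      rintro rfl
      rw [T.depth_root] at hd
      omega
    have hd' := depth_parent hz
    rw [ih (T.parent z) (by omega), ← Set.ncard_insert_of_notMem (a := T.parent z) (by simp)]
    congr 1
    ext w
    simp only [Set.mem_insert_iff, Set.mem_ofPred_eq]
    constructor
    · rintro (rfl | ⟨h, -⟩)
      · exact ⟨T.isAncestor_parent z, parent_ne hz⟩
      · exact ⟨h.trans (T.isAncestor_parent z), fun e => not_isAncestor_parent hz (e ▸ h)⟩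
    · rintro ⟨h, hne⟩
      by_cases hw : w = T.parent z
      · exact Or.inl hw
      · exact Or.inr ⟨h.isAncestor_parent hne, hw⟩

theorem pathVertex_isAncestor (T : RootedTreeOn V) (v : V) (j : ℕ) :
    T.IsAncestor (T.pathVertex v j) v := ⟨_, rfl⟩

theorem eq_of_depth_eq (h : T.IsAncestor u w) (h' : T.IsAncestor v w)
    (hd : T.depth u = T.depth v) : u = v := by
  rcases isAncestor_total h h' with h | h
  · exact h.eq_of_depth_le hd.ge
  · exact (h.eq_of_depth_le hd.le).symm

theorem pathVertex_depth (h : T.IsAncestor u v) : T.pathVertex v (T.depth u) = u :=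
  eq_of_depth_eq (T.pathVertex_isAncestor v _) h (T.depth_pathVertex v h.depth_le)

/-- A finite partial order with a least element in which the elements below any given element are
comparable is the ancestor relation of a rooted tree. -/
theorem exists_isAncestor_iff [Finite V] (r : V → V → Prop) (refl : ∀ u, r u u)
    (trans : ∀ u v w, r u v → r v w → r u w) (antisymm : ∀ u v, r u v → r v u → u = v)
    (total : ∀ u v w, r u w → r v w → r u v ∨ r v u) (ρ : V) (hρ : ∀ z, r ρ z) :
    ∃ T : RootedTreeOn V, ∀ u z, T.IsAncestor u z ↔ r u z := by
  classical
  have hpar : ∀ z, ∃ p, if z = ρ then p = ρ else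
      r p z ∧ p ≠ z ∧ ∀ u, r u z → u ≠ z → r u p := by
    intro z
    by_cases hz : z = ρ
    · exact ⟨ρ, by simp [hz]⟩
    · simp only [if_neg hz]
      -- The parent of z is the greatest element strictly below z in the order `r`, found as the one
      -- with the most predecessors.
      obtain ⟨p, ⟨hp, hpz⟩, hmax⟩ := Set.exists_max_image {u | r u z ∧ u ≠ z}
        (fun u => {w | r w u}.ncard) (Set.toFinite _) ⟨ρ, hρ z, Ne.symm hz⟩
      refine ⟨p, hp, hpz, fun u hu hne => ?_⟩
      rcases total u p z hu hp with h | h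
      · exact h
      · have h1 := hmax u ⟨hu, hne⟩
        have h2 : {w | r w p} = {w | r w u} :=
          Set.eq_of_subset_of_ncard_le (fun w hw => trans _ _ _ hw h) h1 (Set.toFinite _)
        have h3 : u ∈ {w | r w p} := h2 ▸ refl u
        exact h3
  choose p hp using hpar
  have hpρ : p ρ = ρ := by simpa using hp ρ
  have hp' : ∀ z, z ≠ ρ → r (p z) z ∧ p z ≠ z ∧ ∀ u, r u z → u ≠ z → r u (p z) := by
    intro z hz
    simpa [hz] using hp z
  let T : RootedTreeOn V :=
    { root := ρ
      parent := p
      parent_root := hpρ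
      exists_iterate := by
        intro v
        induction hn : {w | r w v}.ncard using Nat.strong_induction_on generalizing v with
        | _ n ih =>
          by_cases hv : v = ρ
          · exact ⟨0, hv⟩
          · obtain ⟨h1, h2, -⟩ := hp' v hv
            have hlt : {w | r w (p v)}.ncard < {w | r w v}.ncard := by
              apply Set.ncard_lt_ncard _ (Set.toFinite _)
              refine ⟨fun w hw => trans _ _ _ hw h1, fun hsub => h2 ?_⟩
              exact antisymm _ _ h1 (hsub (refl v))
            obtain ⟨m, hm⟩ := ih _ (hn ▸ hlt) (p v) rfl
            exact ⟨m + 1, by rwa [Function.iterate_succ_apply]⟩ }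
  refine ⟨T, fun u z => isAncestor_iff_of_step (P := fun z => r u z) (fun z => ?_) z⟩
  change r u z ↔ z = u ∨ (z ≠ ρ ∧ r u (p z))
  constructor
  · intro h
    by_cases hz : z = u
    · exact Or.inl hz
    · right
      have hzρ : z ≠ ρ := by
        rintro rfl
        exact hz (antisymm _ _ (hρ u) h)
      exact ⟨hzρ, (hp' z hzρ).2.2 u h (Ne.symm hz)⟩
  · rintro (rfl | ⟨hz, h⟩)
    · exact refl z
    · exact trans _ _ _ h (hp' z hz).1

end RootedTreeOn

/-! ### Connected components without walks -/

/-- No non-empty proper subset of `S` is separated in `G` from the rest of `S`. -/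
def SimpleGraph.IsConnectedOn {V : Type*} (G : SimpleGraph V) (S : Set V) : Prop :=
  ∀ A ⊆ S, A.Nonempty → A ≠ S → ∃ z ∈ A, ∃ y ∈ S, y ∉ A ∧ G.Adj z y

section Components

variable {V : Type*} {G : SimpleGraph V} {S C : Set V}

theorem SimpleGraph.Connected.isConnectedOn_univ (hG : G.Connected) :
    G.IsConnectedOn Set.univ := by
  intro A _ hA hne
  obtain ⟨z, hz⟩ := hA
  obtain ⟨y, hy⟩ := (Set.ne_univ_iff_exists_notMem A).1 hne
  obtain ⟨p⟩ := hG.preconnected z y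
  obtain ⟨d, -, h1, h2⟩ := p.exists_boundary_dart A hz hy
  exact ⟨_, h1, _, trivial, h2, d.adj⟩

/-- Trades walks in an induced subgraph for statements about edges between subsets of `V`. Both
directions follow a walk to the first edge that leaves a given set. -/
theorem isComponentOf_iff : IsComponentOf G S C ↔
    C.Nonempty ∧ C ⊆ S ∧ (∀ z ∈ C, ∀ y ∈ S, y ∉ C → ¬ G.Adj z y) ∧ G.IsConnectedOn C := by
  constructor
  · rintro ⟨c, rfl⟩
    refine ⟨c.nonempty_supp.image _, ?_, ?_, ?_⟩
    · rintro _ ⟨z, -, rfl⟩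
      exact z.2
    · rintro _ ⟨z, hz, rfl⟩ y hy hyC hadj
      refine hyC ⟨⟨y, hy⟩, ?_, rfl⟩
      have h : (G.induce S).Adj z ⟨y, hy⟩ := hadj
      exact (c.mem_supp_congr_adj h).1 hz
    · rintro A hA ⟨z, hz⟩ hne
      obtain ⟨y, hy, hyA⟩ := Set.not_subset.1 (fun h => hne (hA.antisymm h))
      obtain ⟨z, hzc, rfl⟩ := hA hz
      obtain ⟨y, hyc, rfl⟩ := hy
      obtain ⟨p⟩ : (G.induce S).Reachable z y :=
        SimpleGraph.ConnectedComponent.exact (hzc.trans hyc.symm)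
      obtain ⟨d, -, h1, h2⟩ := p.exists_boundary_dart (Subtype.val ⁻¹' A) hz hyA
      obtain ⟨w, hw, hwd⟩ := hA h1
      have hw' : w = d.fst := Subtype.ext hwd
      exact ⟨_, h1, d.snd, ⟨d.snd, (c.mem_supp_congr_adj d.adj).1 (hw' ▸ hw), rfl⟩, h2, d.adj⟩
  · rintro ⟨⟨z, hz⟩, hCS, hout, hconn⟩
    refine ⟨(G.induce S).connectedComponentMk ⟨z, hCS hz⟩, ?_⟩
    set c := (G.induce S).connectedComponentMk ⟨z, hCS hz⟩ with hc
    apply Set.Subset.antisymm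
    · by_contra hsub
      obtain ⟨u, ⟨huC, huc⟩, y, hy, hyn, hadj⟩ := hconn (C ∩ Subtype.val '' c.supp)
        Set.inter_subset_left ⟨z, hz, ⟨z, hCS hz⟩, rfl, rfl⟩
        (fun h => hsub (h ▸ Set.inter_subset_right))
      obtain ⟨u, hu, rfl⟩ := huc
      have h : (G.induce S).Adj u ⟨y, hCS hy⟩ := hadj
      exact hyn ⟨hy, ⟨y, hCS hy⟩, (c.mem_supp_congr_adj h).1 hu, rfl⟩
    · rintro _ ⟨y, hy, rfl⟩
      by_contra hyC
      obtain ⟨p⟩ : (G.induce S).Reachable ⟨z, hCS hz⟩ y :=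
        SimpleGraph.ConnectedComponent.exact hy.symm
      obtain ⟨d, -, h1, h2⟩ := p.exists_boundary_dart (Subtype.val ⁻¹' C) hz hyC
      exact hout _ h1 _ d.snd.2 h2 d.adj

theorem SimpleGraph.IsConnectedOn.subset_of_inter {D : Set V} (hD : G.IsConnectedOn D)
    (hDS : D ⊆ S) (hout : ∀ z ∈ C, ∀ y ∈ S, y ∉ C → ¬ G.Adj z y) (hne : (D ∩ C).Nonempty) :
    D ⊆ C := by
  by_contra hsub
  obtain ⟨u, ⟨-, huC⟩, y, hy, hyn, hadj⟩ := hD (D ∩ C) Set.inter_subset_left hne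
    (fun h => hsub (h ▸ Set.inter_subset_right))
  exact hout u huC y (hDS hy) (fun h => hyn ⟨hy, h⟩) hadj

end Components

/-! ### Search trees in terms of the ancestor order -/

/-- The local description of search trees: adjacent vertices are comparable, and the parent of `c`
is adjacent to a vertex of the subtree rooted in `c`. -/
structure IsElimTree {V : Type*} (G : SimpleGraph V) (T : RootedTreeOn V) : Prop where
  comparable : ∀ u v, G.Adj u v → T.IsAncestor u v ∨ T.IsAncestor v u
  exists_adj : ∀ c, c ≠ T.root → ∃ z, T.IsAncestor c z ∧ G.Adj (T.parent c) z

section SearchTree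

open RootedTreeOn

variable {V : Type*} {G : SimpleGraph V} {T : RootedTreeOn V}

/-- The three claims share one induction: comparability and the adjacency witness at a child both
need that a component is the full subtree below its root. -/
theorem IsSearchTreeOn.elim_on {S : Set V} {r : V} (h : IsSearchTreeOn G T S r)
    (hS : G.IsConnectedOn S) :
    (∀ z, z ∈ S ↔ T.IsAncestor r z) ∧
      (∀ u ∈ S, ∀ v ∈ S, G.Adj u v → T.IsAncestor u v ∨ T.IsAncestor v u) ∧
      ∀ c ∈ S, c ≠ r → ∃ z, T.IsAncestor c z ∧ G.Adj (T.parent c) z := by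
  induction h with
  | mk S r hr f children subtrees ih =>
    have ih' := fun C hC => ih C hC (isComponentOf_iff.1 hC).2.2.2
    have hcomp : ∀ z ∈ S, z ≠ r → ∃ C, IsComponentOf G (S \ {r}) C ∧ z ∈ C := fun z hz hzr =>
      ⟨_, ⟨(G.induce (S \ {r})).connectedComponentMk ⟨z, hz, hzr⟩, rfl⟩, ⟨z, hz, hzr⟩, rfl, rfl⟩
    have hmem : ∀ z, z ∈ S ↔ T.IsAncestor r z := by
      intro z
      constructor
      · intro hz
        by_cases hzr : z = r
        · exact hzr ▸ IsAncestor.refl T z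
        · obtain ⟨C, hC, hzC⟩ := hcomp z hz hzr
          exact ((children _).2 ⟨C, hC, rfl⟩).isAncestor.trans (((ih' C hC).1 z).1 hzC)
      · intro hz
        by_cases hzr : r = z
        · exact hzr ▸ hr
        · obtain ⟨c, hc, hcz⟩ := exists_isChild hz hzr
          obtain ⟨C, hC, rfl⟩ := (children c).1 hc
          exact ((isComponentOf_iff.1 hC).2.1 (((ih' C hC).1 z).2 hcz)).1
    refine ⟨hmem, ?_, ?_⟩
    · intro u hu v hv hadj
      by_cases hur : u = r
      · exact Or.inl (hur ▸ (hmem v).1 hv)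
      by_cases hvr : v = r
      · exact Or.inr (hvr ▸ (hmem u).1 hu)
      obtain ⟨C, hC, huC⟩ := hcomp u hu hur
      have hvC : v ∈ C := by
        by_contra hvC
        exact (isComponentOf_iff.1 hC).2.2.1 u huC v ⟨hv, hvr⟩ hvC hadj
      exact (ih' C hC).2.1 u huC v hvC hadj
    · intro c hc hcr
      obtain ⟨C, hC, hcC⟩ := hcomp c hc hcr
      by_cases hcf : c = f C
      · have hch := (children _).2 ⟨C, hC, rfl⟩
        obtain ⟨hne, hsub, hout, -⟩ := isComponentOf_iff.1 hC
        -- Since r lies in S but not in C, connectivity of S gives an edge leaving C, and its other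
        -- end can only be r.
        obtain ⟨z, hz, y, hy, hyC, hadj⟩ := hS C (fun z hz => (hsub hz).1) hne
          (fun h => (hsub (h.symm ▸ hr : r ∈ C)).2 rfl)
        have hyr : y = r := by
          by_contra hyr
          exact hout z hz y ⟨hy, hyr⟩ hyC hadj
        subst hyr hcf
        exact ⟨z, ((ih' C hC).1 z).1 hz, hch.2.symm ▸ hadj.symm⟩
      · exact (ih' C hC).2.2 c hcC hcf

/-- By induction the subtree of each child c of r is connected, and `exists_adj` joins it to r. A
set without outgoing edges therefore contains the subtree of c if it contains r, and misses it
otherwise. -/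
theorem IsElimTree.isConnectedOn [Finite V] (h : IsElimTree G T) (r : V) :
    G.IsConnectedOn {z | T.IsAncestor r z} := by
  induction hn : {z | T.IsAncestor r z}.ncard using Nat.strong_induction_on generalizing r with
  | _ n ih =>
    intro A hA hne hAS
    by_contra hcon
    push Not at hcon
    have hout : ∀ z ∈ A, ∀ y ∈ {z | T.IsAncestor r z}, y ∉ A → ¬ G.Adj z y := hcon
    have hchild : ∀ c, T.IsChild c r → ∀ z, T.IsAncestor c z → (z ∈ A ↔ r ∈ A) := by
      intro c hc z hz
      have hsub : {z | T.IsAncestor c z} ⊆ {z | T.IsAncestor r z} :=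
        fun y hy => hc.isAncestor.trans hy
      have hlt : {z | T.IsAncestor c z}.ncard < {z | T.IsAncestor r z}.ncard := by
        apply Set.ncard_lt_ncard ⟨hsub, fun h' => ?_⟩ (Set.toFinite _)
        exact hc.ne (hc.isAncestor.antisymm (h' (IsAncestor.refl T r)))
      have hcc := ih _ (hn ▸ hlt) c rfl
      obtain ⟨y, hy, hadj⟩ := h.exists_adj c hc.1
      rw [hc.2] at hadj
      constructor
      · intro hzA
        have hyA := hcc.subset_of_inter hsub hout ⟨z, hz, hzA⟩ hy
        by_contra hrA
        exact hout y hyA r (IsAncestor.refl T r) hrA hadj.symm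
      · intro hrA
        have hyA : y ∈ A := by
          by_contra hyA
          exact hout r hrA y (hsub hy) hyA hadj
        exact hcc.subset_of_inter hsub hout ⟨y, hy, hyA⟩ hz
    have hall : ∀ z, T.IsAncestor r z → (z ∈ A ↔ r ∈ A) := by
      intro z hz
      by_cases hzr : r = z
      · rw [hzr]
      · obtain ⟨c, hc, hcz⟩ := exists_isChild hz hzr
        exact hchild c hc z hcz
    obtain ⟨z, hz⟩ := hne
    have hrA : r ∈ A := (hall z (hA hz)).1 hz
    exact hAS (hA.antisymm fun y hy => (hall y hy).2 hrA)

/-- Vertices below different children of r are incomparable, hence not adjacent, and the subtree of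
each child is connected. -/
theorem IsElimTree.isComponentOf_iff [Finite V] (h : IsElimTree G T) (r : V) (C : Set V) :
    IsComponentOf G ({z | T.IsAncestor r z} \ {r}) C ↔
      ∃ c, T.IsChild c r ∧ C = {z | T.IsAncestor c z} := by
  have hsub : ∀ c, T.IsChild c r →
      {z | T.IsAncestor c z} ⊆ {z | T.IsAncestor r z} \ {r} := by
    intro c hc z hz
    refine ⟨hc.isAncestor.trans hz, ?_⟩
    rintro rfl
    exact hc.ne (hc.isAncestor.antisymm hz)
  have hout : ∀ c, T.IsChild c r → ∀ z ∈ {z | T.IsAncestor c z},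
      ∀ y ∈ {z | T.IsAncestor r z} \ {r}, y ∉ {z | T.IsAncestor c z} → ¬ G.Adj z y := by
    rintro c hc z hz y ⟨hy, hyr⟩ hyc hadj
    rcases h.comparable _ _ hadj with hzy | hyz
    · exact hyc (hz.trans hzy)
    · rcases isAncestor_total hz hyz with hcy | hyc'
      · exact hyc hcy
      · have hne : y ≠ c := fun e => hyc (e ▸ IsAncestor.refl T y)
        exact hyr ((hc.isAncestor_of_ne hyc' hne).antisymm hy)
  constructor
  · intro hC
    obtain ⟨⟨z, hz⟩, hCS, hCout, hconn⟩ := _root_.isComponentOf_iff.1 hC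
    obtain ⟨hrz, hzr⟩ := hCS hz
    obtain ⟨c, hc, hcz⟩ := exists_isChild hrz (Ne.symm hzr)
    refine ⟨c, hc, Set.Subset.antisymm ?_ ?_⟩
    · exact hconn.subset_of_inter hCS (hout c hc) ⟨z, hz, hcz⟩
    · exact (h.isConnectedOn c).subset_of_inter (hsub c hc) hCout ⟨z, hcz, hz⟩
  · rintro ⟨c, hc, rfl⟩
    exact _root_.isComponentOf_iff.2
      ⟨⟨c, IsAncestor.refl T c⟩, hsub c hc, hout c hc, h.isConnectedOn c⟩

theorem IsElimTree.isSearchTreeOn [Finite V] (h : IsElimTree G T) (r : V) :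
    IsSearchTreeOn G T {z | T.IsAncestor r z} r := by
  induction hn : {z | T.IsAncestor r z}.ncard using Nat.strong_induction_on generalizing r with
  | _ n ih =>
    have : Nonempty V := ⟨r⟩
    have hinj : Function.Injective fun c => {z | T.IsAncestor c z} := by
      intro c d hcd
      have h1 : d ∈ {z | T.IsAncestor c z} := by
        rw [show {z | T.IsAncestor c z} = {z | T.IsAncestor d z} from hcd]
        exact IsAncestor.refl T d
      have h2 : c ∈ {z | T.IsAncestor d z} := by
        rw [← show {z | T.IsAncestor c z} = {z | T.IsAncestor d z} from hcd]
        exact IsAncestor.refl T c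
      exact IsAncestor.antisymm h1 h2
    -- A vertex is recovered from the set of its descendants, so the inverse of this map sends each
    -- component to its root.
    have hf := Function.leftInverse_invFun hinj
    refine .mk _ r (IsAncestor.refl T r)
      (Function.invFun fun c => {z | T.IsAncestor c z}) ?_ ?_
    · intro w
      constructor
      · intro hw
        exact ⟨_, (h.isComponentOf_iff r _).2 ⟨w, hw, rfl⟩, (hf w).symm⟩
      · rintro ⟨C, hC, rfl⟩
        obtain ⟨c, hc, rfl⟩ := (h.isComponentOf_iff r C).1 hC
        exact (hf c).symm ▸ hc
    · intro C hC
      obtain ⟨c, hc, rfl⟩ := (h.isComponentOf_iff r C).1 hC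
      rw [hf c]
      refine ih _ (hn ▸ ?_) c rfl
      apply Set.ncard_lt_ncard ⟨fun z hz => hc.isAncestor.trans hz, fun h' => ?_⟩ (Set.toFinite _)
      exact hc.ne (hc.isAncestor.antisymm (h' (IsAncestor.refl T r)))

/-- On a connected graph, search trees are the trees described locally by `IsElimTree`. -/
theorem isSearchTree_iff [Finite V] (hG : G.Connected) : IsSearchTree G T ↔ IsElimTree G T := by
  constructor
  · intro h
    obtain ⟨-, h2, h3⟩ := IsSearchTreeOn.elim_on h hG.isConnectedOn_univ
    exact ⟨fun u v => h2 u trivial v trivial, fun c => h3 c trivial⟩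
  · intro h
    have h' := h.isSearchTreeOn T.root
    rwa [show {z | T.IsAncestor T.root z} = Set.univ from
      Set.eq_univ_of_forall T.root_isAncestor] at h'

end SearchTree

/-! ### Rotations in terms of the ancestor order -/

namespace RootedTreeOn

variable {V : Type*} {G : SimpleGraph V} {T T' : RootedTreeOn V} {a b : V}

/-- `T'` is obtained from `T` by exchanging `a` with the vertex `b` below it, without changing the
vertex sets of the subtrees rooted in other vertices. -/
structure IsFlip (T T' : RootedTreeOn V) (a b : V) : Prop where
  ne : a ≠ b
  iff_of_ne : ∀ w, w ≠ a → w ≠ b → ∀ z, T.IsAncestor w z ↔ T'.IsAncestor w z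
  left : T.IsAncestor a b
  right : T'.IsAncestor b a

namespace IsFlip

theorem symm (h : IsFlip T T' a b) : IsFlip T' T b a :=
  ⟨h.ne.symm, fun w hb ha z => (h.iff_of_ne w ha hb z).symm, h.right, h.left⟩

theorem not_left (h : IsFlip T T' a b) : ¬ T.IsAncestor b a := fun h' =>
  h.ne (h.left.antisymm h')

theorem trees_ne (h : IsFlip T T' a b) : T ≠ T' := by
  rintro rfl
  exact h.not_left h.right

/-- A third vertex w above b in `T` is above b in `T'`, hence above a there, hence above a in `T`.
So nothing lies between a and b. -/
theorem isChild (h : IsFlip T T' a b) : T.IsChild b a := by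
  refine ⟨ne_root_of_isAncestor h.left h.ne, parent_eq h.left h.ne fun w hw hwb => ?_⟩
  by_cases hwa : w = a
  · exact hwa ▸ IsAncestor.refl T w
  · exact (h.iff_of_ne w hwa hwb a).2 (((h.iff_of_ne w hwa hwb b).1 hw).trans h.right)

theorem isAncestor_right_of_ne (h : IsFlip T T' a b) {w : V} (hwb : w ≠ b)
    (hw : T.IsAncestor w b) : T.IsAncestor w a := h.isChild.isAncestor_of_ne hw hwb

/-- A child of `a` other than `b` stays below `a`. -/
theorem isAncestor_child_left (h : IsFlip T T' a b) (hT : IsElimTree G T) (hT' : IsElimTree G T')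
    {c : V} (hc : T.IsChild c a) (hcb : c ≠ b) : T'.IsAncestor a c := by
  obtain ⟨y, hy, hadj⟩ := hT.exists_adj c hc.1
  rw [hc.2] at hadj
  have hya : ¬ T.IsAncestor y a := fun h' => hc.ne (hc.isAncestor.antisymm (hy.trans h'))
  have hyb : y ≠ b := by
    rintro rfl
    exact hc.ne (hc.isAncestor.antisymm (h.isAncestor_right_of_ne hcb hy))
  have hya' : y ≠ a := fun e => hya (e ▸ IsAncestor.refl T y)
  have hay : T'.IsAncestor a y := by
    rcases hT'.comparable _ _ hadj with h' | h'
    · exact h'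
    · exact (hya ((h.iff_of_ne y hya' hyb a).2 h')).elim
  rcases isAncestor_total hay ((h.iff_of_ne c hc.ne.symm hcb y).1 hy) with h' | h'
  · exact h'
  · exact (hc.ne (hc.isAncestor.antisymm ((h.iff_of_ne c hc.ne.symm hcb a).2 h'))).elim

/-- The subtrees of `b` with a vertex adjacent to `a` are those that move below `a`. -/
theorem isAncestor_child_right_iff (h : IsFlip T T' a b) (hT' : IsElimTree G T')
    {c : V} (hc : T.IsChild c b) :
    T'.IsAncestor a c ↔ ∃ z, T.IsAncestor c z ∧ G.Adj a z := by
  have hac := h.left.trans hc.isAncestor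
  have hcb : ¬ T.IsAncestor c b := fun h' => hc.ne (hc.isAncestor.antisymm h')
  have hca : ¬ T.IsAncestor c a := fun h' => hcb (h'.trans h.left)
  have hca' : c ≠ a := fun e => hca (e ▸ IsAncestor.refl T c)
  have hiff := h.iff_of_ne c hca' hc.ne.symm
  constructor
  · intro h'
    -- The child d of a in `T'` towards c turns out to be c itself: d is an ancestor of c in `T` but
    -- not of b, and c is a child of b. Then `exists_adj` at d gives the required neighbour of a.
    obtain ⟨d, hd, hdc⟩ := exists_isChild h' hca'.symm
    have hdb : d ≠ b := by
      rintro rfl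
      exact h.symm.not_left hd.isAncestor
    have hdiff := h.iff_of_ne d hd.ne.symm hdb
    have hdc' := (hdiff c).2 hdc
    have hbd : T.IsAncestor b d := by
      rcases isAncestor_total hc.isAncestor hdc' with h1 | h1
      · exact h1
      · exact (hd.ne (hd.isAncestor.antisymm
          ((hdiff a).1 (h.isAncestor_right_of_ne hdb h1)))).elim
    have hdc2 : d = c := by
      by_contra hne
      exact hdb ((hc.isAncestor_of_ne hdc' hne).antisymm hbd)
    obtain ⟨z, hz, hadj⟩ := hT'.exists_adj d hd.1
    rw [hd.2] at hadj
    subst hdc2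
    exact ⟨z, (hdiff z).2 hz, hadj⟩
  · rintro ⟨z, hz, hadj⟩
    have hza : z ≠ a := fun e => hca (e ▸ hz)
    have hzb : z ≠ b := fun e => hcb (e ▸ hz)
    have haz : T'.IsAncestor a z := by
      rcases hT'.comparable _ _ hadj with h' | h'
      · exact h'
      · exact (hca (hz.trans ((h.iff_of_ne z hza hzb a).2 h'))).elim
    rcases isAncestor_total haz ((hiff z).1 hz) with h' | h'
    · exact h'
    · exact (hca ((hiff a).2 h')).elim

theorem isAncestor_child_right (h : IsFlip T T' a b) (hT : IsElimTree G T)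
    (hT' : IsElimTree G T') {c : V} (hc : T.IsChild c b) : T'.IsAncestor b c := by
  obtain ⟨y, hy, hadj⟩ := hT.exists_adj c hc.1
  rw [hc.2] at hadj
  have hcb : ¬ T.IsAncestor c b := fun h' => hc.ne (hc.isAncestor.antisymm h')
  have hca : ¬ T.IsAncestor c a := fun h' => hcb (h'.trans h.left)
  have hiff := h.iff_of_ne c (fun e => hca (e ▸ IsAncestor.refl T c)) hc.ne.symm
  have hya : y ≠ a := fun e => hca (e ▸ hy)
  have hyb : y ≠ b := fun e => hcb (e ▸ hy)
  have hby : T'.IsAncestor b y := by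
    rcases hT'.comparable _ _ hadj with h' | h'
    · exact h'
    · exact (hcb (hy.trans ((h.iff_of_ne y hya hyb b).2 h'))).elim
  rcases isAncestor_total hby ((hiff y).1 hy) with h' | h'
  · exact h'
  · exact (hcb ((hiff b).2 h')).elim

/-- The vertex set of the subtree below the exchanged pair does not change. -/
theorem top_of_left (h : IsFlip T T' a b) (hT : IsElimTree G T) (hT' : IsElimTree G T') {z : V}
    (hz : T.IsAncestor a z) : T'.IsAncestor b z := by
  by_cases hza : a = z
  · exact hza ▸ h.right
  obtain ⟨c, hc, hcz⟩ := exists_isChild hz hza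
  by_cases hcb : c = b
  · subst hcb
    by_cases hzc : c = z
    · exact hzc ▸ IsAncestor.refl T' c
    · obtain ⟨d, hd, hdz⟩ := exists_isChild hcz hzc
      have hda : d ≠ a := by
        rintro rfl
        exact h.not_left hd.isAncestor
      exact (h.isAncestor_child_right hT hT' hd).trans
        ((h.iff_of_ne d hda hd.ne.symm z).1 hdz)
  · exact (h.right.trans (h.isAncestor_child_left hT hT' hc hcb)).trans
      ((h.iff_of_ne c hc.ne.symm hcb z).1 hcz)

theorem top_iff (h : IsFlip T T' a b) (hT : IsElimTree G T) (hT' : IsElimTree G T') (z : V) :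
    T.IsAncestor a z ↔ T'.IsAncestor b z :=
  ⟨h.top_of_left hT hT', h.symm.top_of_left hT' hT⟩

/-- Above the exchanged pair nothing changes. -/
theorem above_iff (h : IsFlip T T' a b) {w : V} (ha : w ≠ a) (hb : w ≠ b) :
    T.IsAncestor w a ↔ T'.IsAncestor w b := by
  rw [← h.iff_of_ne w ha hb b]
  exact ⟨fun h' => h'.trans h.left, h.isAncestor_right_of_ne hb⟩

/-- Each clause on parents names the lowest strict ancestor in `T'`. Below the pair this uses that
both trees are search trees, since the flip alone does not say where the descendants of a and b go.
-/
theorem isRotation (h : IsFlip T T' a b) (hT : IsElimTree G T) (hT' : IsElimTree G T') :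
    IsRotation G T a b T' := by
  have hroot : a ≠ T.root → T'.root = T.root := by
    intro ha
    symm
    refine isAncestor_root_iff.1 ((h.iff_of_ne T.root ha.symm ?_ _).1 (T.root_isAncestor _))
    exact h.isChild.1.symm
  refine ⟨h.isChild, ?_, ?_, h.symm.isChild, ?_, ?_, ?_⟩
  · split_ifs with ha
    · symm
      apply isAncestor_root_iff.1
      rw [← h.top_iff hT hT', ha]
      exact T.root_isAncestor _
    · exact hroot ha
  · intro ha
    have hpa := parent_ne ha
    have hpb : T.parent a ≠ b := fun e => h.not_left (e ▸ T.isAncestor_parent a)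
    refine parent_eq ((h.above_iff hpa hpb).1 (T.isAncestor_parent a)) hpb fun w hw hwb => ?_
    have hwa : w ≠ a := fun e => h.symm.not_left (e ▸ hw)
    have hiff := h.iff_of_ne w hwa hwb
    exact (hiff _).1 (((h.above_iff hwa hwb).2 hw).isAncestor_parent hwa)
  · intro w hw hwb
    refine parent_eq (h.isAncestor_child_left hT hT' hw hwb) hw.ne fun q hq hqw => ?_
    by_cases hqa : q = a
    · exact hqa ▸ IsAncestor.refl T' q
    by_cases hqb : q = b
    · exact hqb ▸ h.right
    have hiff := h.iff_of_ne q hqa hqb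
    exact (hiff _).1 (hw.isAncestor_of_ne ((hiff _).2 hq) hqw)
  · intro w hw
    have hwa : w ≠ a := by
      rintro rfl
      exact h.not_left hw.isAncestor
    split_ifs with hz
    · refine parent_eq ((h.isAncestor_child_right_iff hT' hw).2 hz) hwa.symm
        fun q hq hqw => ?_
      by_cases hqa : q = a
      · exact hqa ▸ IsAncestor.refl T' q
      by_cases hqb : q = b
      · exact hqb ▸ h.right
      have hiff := h.iff_of_ne q hqa hqb
      exact (hiff _).1 (h.isAncestor_right_of_ne hqb (hw.isAncestor_of_ne ((hiff _).2 hq) hqw))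
    · rw [← h.isAncestor_child_right_iff hT' hw] at hz
      refine parent_eq (h.isAncestor_child_right hT hT' hw) hw.ne fun q hq hqw => ?_
      have hqa : q ≠ a := fun e => hz (e ▸ hq)
      by_cases hqb : q = b
      · exact hqb ▸ IsAncestor.refl T' q
      have hiff := h.iff_of_ne q hqa hqb
      exact (hiff _).1 (hw.isAncestor_of_ne ((hiff _).2 hq) hqw)
  · intro w hwa hwb hpa hpb
    have hiffw := h.iff_of_ne w hwa hwb
    by_cases hw : w = T.root
    · by_cases ha : a = T.root
      · exact absurd (hw.trans ha.symm) hwa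
      · rw [hw, T.parent_root, ← hroot ha, T'.parent_root]
    · have hiff := h.iff_of_ne _ hpa hpb
      refine parent_eq ((hiff _).1 (T.isAncestor_parent w)) (parent_ne hw) fun q hq hqw => ?_
      -- If q lies in the subtree of b in `T'`, it may be a or b itself, and `top_iff` has to
      -- replace the invariance of descendants.
      by_cases hq' : T'.IsAncestor b q
      · have haw : T.IsAncestor a w := (h.top_iff hT hT' w).2 (hq'.trans hq)
        by_cases hqa : q = a
        · subst hqa
          rcases isAncestor_total hq ((hiff w).1 (T.isAncestor_parent w)) with h' | h'
          · exact h'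
          · exact (hpa (((hiff _).2 h').antisymm (haw.isAncestor_parent hwa.symm))).elim
        · by_cases hqb : q = b
          · subst hqb
            exact (h.top_iff hT hT' _).1 (haw.isAncestor_parent hwa.symm)
          · have hiffq := h.iff_of_ne q hqa hqb
            exact (hiffq _).1 (((hiffq _).2 hq).isAncestor_parent hqw)
      · have hqa : q ≠ a := fun e => hq' (e ▸ h.right)
        have hqb : q ≠ b := fun e => hq' (e ▸ IsAncestor.refl T' q)
        have hiffq := h.iff_of_ne q hqa hqb
        exact (hiffq _).1 (((hiffq _).2 hq).isAncestor_parent hqw)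

end IsFlip

/-- For a third vertex u, the descendants of u in `T` satisfy the recursion along the parent map of
`T'`. The changed parents do no harm, because u is above a exactly when it is above b. -/
theorem IsRotation.isFlip (h : IsRotation G T a b T') : IsFlip T T' a b := by
  have hab := h.isChild
  refine ⟨hab.ne, fun u hua hub z => ?_, hab.isAncestor, h.isChild_u.isAncestor⟩
  symm
  refine isAncestor_iff_of_step (P := fun z => T.IsAncestor u z) (fun z => ?_) z
  have hb : T.IsAncestor u b ↔ T.IsAncestor u a :=
    ⟨fun h' => hab.isAncestor_of_ne h' hub, fun h' => h'.trans hab.isAncestor⟩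
  by_cases hza : z = a
  · subst hza
    simp [h.isChild_u.1, h.isChild_u.2, hb, hua.symm]
  by_cases hzb : z = b
  · subst hzb
    have hroot := h.root_eq
    split_ifs at hroot with ha
    · simp only [hroot, ne_eq, not_true_eq_false, false_and, or_false]
      rw [hb, ha, isAncestor_root_iff]
      exact ⟨fun e => absurd (e.trans ha.symm) hua, fun e => absurd e.symm hub⟩
    · have hzr : z ≠ T'.root := hroot ▸ hab.1
      rw [hb, isAncestor_iff_step (z := a), h.parent_v ha]
      simp [ha, hzr, hua.symm, hub.symm]
  have hzr : z ≠ T'.root ↔ z ≠ T.root := by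
    rw [h.root_eq]
    split_ifs with ha
    · simp [hzb, ← ha, hza]
    · rfl
  by_cases hpa : T.parent z = a
  · by_cases hr : z = T.root
    · exact absurd (by rw [← hpa, hr, T.parent_root]) hza
    · rw [isAncestor_iff_step, h.child_u z ⟨hr, hpa⟩ hzb, hpa, hzr]
  by_cases hpb : T.parent z = b
  · by_cases hr : z = T.root
    · exact absurd (by rw [← hpb, hr, T.parent_root]) hzb
    · rw [isAncestor_iff_step, h.child_v z ⟨hr, hpb⟩, hpb, hzr]
      split_ifs
      · rw [hb]
      · rfl
  rw [isAncestor_iff_step, h.parent_other z hza hzb hpa hpb, hzr]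

theorem isRotation_iff (hT : IsElimTree G T) (hT' : IsElimTree G T') :
    IsRotation G T a b T' ↔ IsFlip T T' a b :=
  ⟨IsRotation.isFlip, fun h => h.isRotation hT hT'⟩

end RootedTreeOn

open RootedTreeOn in
-- The inverse of a flip is a flip and a flip changes the tree, so the symmetrization and the
-- exclusion of loops in `fromRel` have no effect.
theorem rotationGraph_adj_iff {V : Type*} [Finite V] {G : SimpleGraph V} (hG : G.Connected)
    {T T' : SearchTree G} : (rotationGraph G).Adj T T' ↔ ∃ a b, IsFlip T.1 T'.1 a b := by
  have hT := (isSearchTree_iff hG).1 T.2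
  have hT' := (isSearchTree_iff hG).1 T'.2
  rw [rotationGraph, SimpleGraph.fromRel_adj]
  simp only [isRotation_iff hT hT', isRotation_iff hT' hT]
  constructor
  · rintro ⟨-, h | ⟨a, b, h⟩⟩
    · exact h
    · exact ⟨b, a, h.symm⟩
  · rintro ⟨a, b, h⟩
    exact ⟨fun e => h.trees_ne (congrArg _ e), Or.inl ⟨a, b, h⟩⟩

/-! ### The ancestor order of an insertion -/

namespace RootedTreeOn

variable {V : Type*} {G : SimpleGraph V} {T T' : RootedTreeOn V} {v w z : V} {i j : ℕ}

theorem isAncestor_pathVertex_iff (hi : i ≤ T.depth v) :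
    T.IsAncestor w (T.pathVertex v i) ↔ T.IsAncestor w v ∧ T.depth w ≤ i := by
  constructor
  · intro h
    exact ⟨h.trans (T.pathVertex_isAncestor v i), T.depth_pathVertex v hi ▸ h.depth_le⟩
  · rintro ⟨h, hd⟩
    rcases isAncestor_total h (T.pathVertex_isAncestor v i) with h' | h'
    · exact h'
    · rw [h'.eq_of_depth_le (by rwa [T.depth_pathVertex v hi])]
      exact IsAncestor.refl T w

theorem insertAt_root_eq (T : RootedTreeOn V) (i : ℕ) (v : V) :
    (T.insertAt i v).root = if i = 0 then none else some T.root := rfl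

theorem insertAt_parent_none (T : RootedTreeOn V) (i : ℕ) (v : V) : (T.insertAt i v).parent none =
    if i = 0 then none else some (T.pathVertex v (i - 1)) := rfl

theorem insertAt_parent_some_of_eq (h : i ≤ T.depth v ∧ w = T.pathVertex v i) :
    (T.insertAt i v).parent (some w) = none := by
  change T.insertParent i v (some w) = none
  simp only [insertParent]
  rw [if_pos h]

theorem insertAt_parent_some_of_not (h : ¬ (i ≤ T.depth v ∧ w = T.pathVertex v i)) :
    (T.insertAt i v).parent (some w) = some (T.parent w) := by
  change T.insertParent i v (some w) = _
  simp only [insertParent]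
  rw [if_neg h]

theorem some_ne_insertAt_root_of_eq (h : i ≤ T.depth v ∧ w = T.pathVertex v i) :
    some w ≠ (T.insertAt i v).root := by
  rw [insertAt_root_eq]
  split_ifs with hi
  · simp
  · intro e
    have h1 := T.depth_pathVertex v h.1
    rw [← h.2, Option.some.inj e, T.depth_root] at h1
    exact hi h1.symm

theorem some_ne_insertAt_root_iff (h : ¬ (i ≤ T.depth v ∧ w = T.pathVertex v i)) :
    some w ≠ (T.insertAt i v).root ↔ w ≠ T.root := by
  rw [insertAt_root_eq]
  split_ifs with hi
  · simp only [ne_eq, reduceCtorEq, not_false_eq_true, true_iff]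
    rintro rfl
    refine h ⟨by omega, ?_⟩
    symm
    apply T.eq_root_of_depth_eq_zero
    rw [T.depth_pathVertex v (by omega), hi]
  · simp

theorem insertAt_isAncestor_some (hi : i ≤ T.depth v + 1) (y : Option V) :
    (T.insertAt i v).IsAncestor (some w) y ↔
      y.elim (T.IsAncestor w v ∧ T.depth w < i) (fun z => T.IsAncestor w z) := by
  refine isAncestor_iff_of_step (P := fun y : Option V =>
    y.elim (T.IsAncestor w v ∧ T.depth w < i) (fun z => T.IsAncestor w z)) (fun y => ?_) y
  cases y with
  | none =>
    rw [insertAt_parent_none, insertAt_root_eq]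
    by_cases h0 : i = 0
    · simp [h0]
    · simp only [h0, if_false, Option.elim_none, Option.elim_some]
      rw [isAncestor_pathVertex_iff (by omega)]
      simp only [reduceCtorEq, ne_eq, not_false_eq_true, true_and, false_or]
      exact and_congr_right fun _ => by omega
  | some z =>
    by_cases h : i ≤ T.depth v ∧ z = T.pathVertex v i
    · rw [insertAt_parent_some_of_eq h]
      simp only [some_ne_insertAt_root_of_eq h, Option.elim_none, Option.elim_some,
        Option.some.injEq, ne_eq, not_false_eq_true, true_and]
      obtain ⟨hi', rfl⟩ := h
      constructor
      · intro h'
        by_cases hw : T.pathVertex v i = w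
        · exact Or.inl hw
        · have h1 := (isAncestor_pathVertex_iff hi').1 h'
          refine Or.inr ⟨h1.1, lt_of_le_of_ne h1.2 fun e => hw ?_⟩
          rw [← e]
          exact pathVertex_depth h1.1
      · rintro (h' | h')
        · exact h' ▸ IsAncestor.refl T _
        · exact (isAncestor_pathVertex_iff hi').2 ⟨h'.1, h'.2.le⟩
    · rw [insertAt_parent_some_of_not h, some_ne_insertAt_root_iff h]
      simp only [Option.elim_some, Option.some.injEq]
      exact isAncestor_iff_step

/-- For `i` beyond the level of `v` the new vertex is a leaf. The condition `i ≤ T.depth v` is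
needed since `pathVertex` then returns `v` by truncated subtraction. -/
theorem insertAt_none_isAncestor (y : Option V) :
    (T.insertAt i v).IsAncestor none y ↔
      y.elim True (fun z => i ≤ T.depth v ∧ T.IsAncestor (T.pathVertex v i) z) := by
  refine isAncestor_iff_of_step (P := fun y : Option V =>
    y.elim True (fun z => i ≤ T.depth v ∧ T.IsAncestor (T.pathVertex v i) z)) (fun y => ?_) y
  cases y with
  | none => simp
  | some z =>
    by_cases h : i ≤ T.depth v ∧ z = T.pathVertex v i
    · rw [insertAt_parent_some_of_eq h]
      exact iff_of_true ⟨h.1, h.2 ▸ IsAncestor.refl T _⟩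
        (Or.inr ⟨some_ne_insertAt_root_of_eq h, trivial⟩)
    · rw [insertAt_parent_some_of_not h, some_ne_insertAt_root_iff h]
      simp only [Option.elim_some, reduceCtorEq, false_or]
      by_cases hi : i ≤ T.depth v
      · rw [isAncestor_iff_step (z := z)]
        have hz : z ≠ T.pathVertex v i := fun e => h ⟨hi, e⟩
        simp [hi, hz]
      · simp [hi]

/-- The index of the insertion above `c` (for `some c`) or at the bottom (for `none`) of the path
to `v`. -/
noncomputable def insertIndex (T : RootedTreeOn V) (v : V) : Option V → ℕ
  | some c => T.depth c
  | none => T.depth v + 1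

/-- The insertion above `c` (for `some c`) or at the bottom (for `none`) of the path to `v`. -/
noncomputable def insertAbove (T : RootedTreeOn V) (v : V) (p : Option V) :
    RootedTreeOn (Option V) :=
  T.insertAt (T.insertIndex v p) v

/-- `p` describes a place on the path to `v`. -/
def IsPlace (T : RootedTreeOn V) (v : V) (p : Option V) : Prop :=
  ∀ c, p = some c → T.IsAncestor c v

variable {p p' : Option V}

theorem isPlace_none (T : RootedTreeOn V) (v : V) : T.IsPlace v none := by
  intro c hc
  simp at hc

theorem isPlace_some {c : V} (h : T.IsAncestor c v) : T.IsPlace v (some c) := by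
  rintro d ⟨⟩
  exact h

theorem IsPlace.insertIndex_le (h : T.IsPlace v p) : T.insertIndex v p ≤ T.depth v + 1 := by
  cases p with
  | none => exact le_rfl
  | some c => exact (h c rfl).depth_le.trans (Nat.le_succ _)

theorem exists_isPlace (hi : i ≤ T.depth v + 1) : ∃ p, T.IsPlace v p ∧ T.insertIndex v p = i := by
  by_cases h : i = T.depth v + 1
  · exact ⟨none, T.isPlace_none v, h.symm⟩
  · exact ⟨_, isPlace_some (T.pathVertex_isAncestor v i), T.depth_pathVertex v (by omega)⟩

theorem insertAbove_some_some (h : T.IsPlace v p) :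
    (T.insertAbove v p).IsAncestor (some w) (some z) ↔ T.IsAncestor w z := by
  rw [insertAbove, insertAt_isAncestor_some h.insertIndex_le]
  rfl

/-- Expressed by order instead of levels, so that it can be transported along a flip. -/
theorem insertAbove_some_none (h : T.IsPlace v p) :
    (T.insertAbove v p).IsAncestor (some w) none ↔
      T.IsAncestor w v ∧ ∀ c, p = some c → T.IsAncestor w c ∧ w ≠ c := by
  rw [insertAbove, insertAt_isAncestor_some h.insertIndex_le]
  cases p with
  | none =>
    simp only [Option.elim_none, insertIndex, reduceCtorEq, false_imp_iff, implies_true, and_true,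
      and_iff_left_iff_imp]
    exact fun h' => Nat.lt_succ_of_le h'.depth_le
  | some c =>
    simp only [Option.elim_none, insertIndex, Option.some.injEq, forall_eq']
    refine and_congr_right fun hw => ⟨fun hd => ?_, fun ⟨h1, h2⟩ => ?_⟩
    · refine ⟨?_, fun e => by simp [e] at hd⟩
      rcases isAncestor_total hw (h c rfl) with h' | h'
      · exact h'
      · exact absurd h'.depth_le (by omega)
    · by_contra hd
      exact h2 (h1.eq_of_depth_le (by omega))

theorem insertAbove_none_some (h : T.IsPlace v p) :
    (T.insertAbove v p).IsAncestor none (some z) ↔ ∃ c, p = some c ∧ T.IsAncestor c z := by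
  rw [insertAbove, insertAt_none_isAncestor]
  cases p with
  | none => simp [insertIndex]
  | some c =>
    simp only [Option.elim_some, insertIndex, Option.some.injEq, exists_eq_left']
    rw [pathVertex_depth (h c rfl)]
    simp [(h c rfl).depth_le]

theorem eq_of_insertAbove_eq {v' : V} (h : T.IsPlace v p) (h' : T'.IsPlace v' p')
    (he : T.insertAbove v p = T'.insertAbove v' p') : T = T' := by
  refine eq_of_isAncestor_iff fun w z => ?_
  rw [← insertAbove_some_some h, he, insertAbove_some_some h']

/-- The place is recovered from the descendants of x: it is the topmost of them in `T`, or `none` if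
there are none. -/
theorem place_eq_of_none_iff (h : T.IsPlace v p) (h' : T.IsPlace v p')
    (he : ∀ z, (T.insertAbove v p).IsAncestor none (some z) ↔
      (T.insertAbove v p').IsAncestor none (some z)) : p = p' := by
  have hmin : ∀ {p}, T.IsPlace v p → ∀ c, p = some c ↔
      (T.insertAbove v p).IsAncestor none (some c) ∧
        ∀ d, (T.insertAbove v p).IsAncestor none (some d) → T.IsAncestor c d := by
    intro p hp c
    simp only [insertAbove_none_some hp]
    constructor
    · rintro rfl
      exact ⟨⟨c, rfl, IsAncestor.refl T c⟩, by rintro d ⟨_, ⟨⟩, hd⟩; exact hd⟩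
    · rintro ⟨⟨d, rfl, hdc⟩, hc⟩
      rw [hdc.antisymm (hc d ⟨d, rfl, IsAncestor.refl T d⟩)]
  refine Option.ext fun c => ?_
  simp only [hmin h, hmin h', he]

variable {K : Finset V} (hK : K.Nonempty)

theorem lowest_mem (T : RootedTreeOn V) : T.lowest K hK ∈ K :=
  (K.exists_max_image T.depth hK).choose_spec.1

theorem depth_le_lowest (T : RootedTreeOn V) {u : V} (hu : u ∈ K) :
    T.depth u ≤ T.depth (T.lowest K hK) :=
  (K.exists_max_image T.depth hK).choose_spec.2 u hu

theorem maxLevel_eq (T : RootedTreeOn V) : T.maxLevel K = T.depth (T.lowest K hK) :=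
  le_antisymm (Finset.sup_le fun _ => T.depth_le_lowest hK) (Finset.le_sup (T.lowest_mem hK))

end RootedTreeOn

open RootedTreeOn

/-! ### Insertions are search trees on G_K -/

section Insertion

variable {V : Type*} {G : SimpleGraph V} {T : RootedTreeOn V} {K : Finset V} (hK : K.Nonempty)

theorem IsElimTree.comparable_of_mem (hT : IsElimTree G T) (hc : G.IsClique (K : Set V)) {u w : V}
    (hu : u ∈ K) (hw : w ∈ K) : T.IsAncestor u w ∨ T.IsAncestor w u := by
  by_cases h : u = w
  · exact Or.inl (h ▸ IsAncestor.refl T u)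
  · exact hT.comparable _ _ (hc hu hw h)

theorem IsElimTree.isAncestor_lowest (hT : IsElimTree G T) (hc : G.IsClique (K : Set V)) {u : V}
    (hu : u ∈ K) : T.IsAncestor u (T.lowest K hK) := by
  rcases hT.comparable_of_mem hc hu (T.lowest_mem hK) with h | h
  · exact h
  · rw [h.eq_of_depth_le (T.depth_le_lowest hK hu)]
    exact IsAncestor.refl T u

theorem IsElimTree.eq_lowest (hT : IsElimTree G T) (hc : G.IsClique (K : Set V)) {u : V}
    (hu : u ∈ K) (h : ∀ w ∈ K, T.IsAncestor w u) : T.lowest K hK = u :=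
  (h _ (T.lowest_mem hK)).antisymm (hT.isAncestor_lowest hK hc hu)

theorem addSimplicial_adj_some {u w : V} :
    (addSimplicial G K).Adj (some u) (some w) ↔ G.Adj u w := Iff.rfl

theorem addSimplicial_adj_some_none {u : V} :
    (addSimplicial G K).Adj (some u) none ↔ u ∈ K := Iff.rfl

theorem addSimplicial_adj_none_some {u : V} :
    (addSimplicial G K).Adj none (some u) ↔ u ∈ K := Iff.rfl

theorem addSimplicial_connected (hG : G.Connected) (hK : K.Nonempty) :
    (addSimplicial G K).Connected := by
  have hsome : ∀ u w : V, (addSimplicial G K).Reachable (some u) (some w) := fun u w =>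
    (hG.preconnected u w).map (⟨some, fun h => h⟩ : G →g addSimplicial G K)
  obtain ⟨k, hk⟩ := hK
  have hnone : ∀ u : V, (addSimplicial G K).Reachable none (some u) := fun u =>
    (SimpleGraph.Adj.reachable (addSimplicial_adj_none_some.2 hk)).trans (hsome k u)
  have : Nonempty (Option V) := ⟨none⟩
  refine SimpleGraph.Connected.mk ?_
  rintro (_ | u) (_ | w)
  · rfl
  · exact hnone w
  · exact (hnone u).symm
  · exact hsome u w

/-- All of K lies on the path to the lowest vertex v, so x is comparable with its neighbours.
Subdividing an edge keeps the sets of old descendants, and v supplies the adjacencies of x. -/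
theorem IsElimTree.insertAbove (hT : IsElimTree G T) (hc : G.IsClique (K : Set V))
    {p : Option V} (hp : T.IsPlace (T.lowest K hK) p) :
    IsElimTree (addSimplicial G K) (T.insertAbove (T.lowest K hK) p) := by
  set v := T.lowest K hK
  set R := T.insertAbove v p
  have hss : ∀ {w z}, R.IsAncestor (some w) (some z) ↔ T.IsAncestor w z :=
    insertAbove_some_some hp
  have hcomp : ∀ u ∈ K, R.IsAncestor (some u) none ∨ R.IsAncestor none (some u) := by
    intro u hu
    have huv := hT.isAncestor_lowest hK hc hu
    rw [insertAbove_some_none hp, insertAbove_none_some hp]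
    by_cases h : ∃ c, p = some c ∧ T.IsAncestor c u
    · exact Or.inr h
    · push Not at h
      refine Or.inl ⟨huv, fun c hpc => ?_⟩
      rcases isAncestor_total huv (hp c hpc) with h' | h'
      · exact ⟨h', fun e => h c hpc (e ▸ IsAncestor.refl T u)⟩
      · exact (h c hpc h').elim
  constructor
  · rintro (_ | u) (_ | w) hadj
    · exact hadj.elim
    · exact (hcomp w hadj).symm
    · exact hcomp u hadj
    · rw [hss, hss]
      exact hT.comparable u w hadj
  · intro y hy
    have h1 := R.isAncestor_parent y
    have h2 := parent_ne hy
    rcases y with _ | w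
    · obtain ⟨q, hq⟩ := Option.ne_none_iff_exists'.1 h2
      rw [hq] at h1
      rw [hq]
      obtain ⟨hqv, hqc⟩ := (insertAbove_some_none hp).1 h1
      -- With x at the bottom its parent is v, which is in K. Otherwise its parent is the old parent
      -- of c, and the old witness for c still lies below x.
      rcases p with _ | c
      · have hvq : R.IsAncestor (some v) (some q) := by
          rw [← hq]
          exact IsAncestor.isAncestor_parent ((insertAbove_some_none hp).2
            ⟨IsAncestor.refl T v, by simp⟩) (by simp)
        refine ⟨none, IsAncestor.refl R _, ?_⟩
        rw [addSimplicial_adj_some_none, hqv.antisymm (hss.1 hvq)]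
        exact T.lowest_mem hK
      · obtain ⟨hqc, hne⟩ := hqc c rfl
        have hcr : c ≠ T.root := ne_root_of_isAncestor hqc hne
        have hrq : R.IsAncestor (some (T.parent c)) (some q) := by
          rw [← hq]
          refine IsAncestor.isAncestor_parent ((insertAbove_some_none hp).2
            ⟨(T.isAncestor_parent c).trans (hp c rfl), ?_⟩) (by simp)
          rintro d ⟨⟩
          exact ⟨T.isAncestor_parent c, parent_ne hcr⟩
        obtain ⟨z, hz, hadj⟩ := hT.exists_adj c hcr
        rw [(hss.1 hrq).antisymm (hqc.isAncestor_parent hne)] at hadj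
        exact ⟨some z, (insertAbove_none_some hp).2 ⟨c, rfl, hz⟩, hadj⟩
    · rcases hq : R.parent (some w) with _ | q
      · rw [hq] at h1
        obtain ⟨c, rfl, hcw⟩ := (insertAbove_none_some hp).1 h1
        by_cases hcw' : c = w
        · subst hcw'
          -- The child c of x has v below it, and v is a neighbour of x.
          exact ⟨some v, hss.2 (hp c rfl), T.lowest_mem hK⟩
        · have h3 := IsAncestor.isAncestor_parent (hss.2 hcw) (by simpa using hcw')
          rw [hq, insertAbove_some_none hp] at h3
          exact ((h3.2 c rfl).2 rfl).elim
      · rw [hq] at h1 h2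
        have hqw := hss.1 h1
        have hne : q ≠ w := by simpa using h2
        have hwr : w ≠ T.root := ne_root_of_isAncestor hqw hne
        obtain ⟨z, hz, hadj⟩ := hT.exists_adj w hwr
        have h3 := IsAncestor.isAncestor_parent (hss.2 (T.isAncestor_parent w))
          (by simpa using parent_ne hwr)
        rw [hq, hss] at h3
        rw [h3.antisymm (hqw.isAncestor_parent hne)] at hadj
        exact ⟨some z, hss.2 hz, hadj⟩

/-! ### Contracting x in a search tree on G_K -/

section Contraction

variable {R : RootedTreeOn (Option V)}

theorem IsElimTree.exists_mem_of_isChild_none (hR : IsElimTree (addSimplicial G K) R) {c : V}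
    (hch : R.IsChild (some c) none) : ∃ u ∈ K, R.IsAncestor (some c) (some u) := by
  obtain ⟨y, hy, hadj⟩ := hR.exists_adj _ hch.1
  rw [hch.2] at hadj
  rcases y with _ | u
  · exact hadj.elim
  · exact ⟨u, hadj, hy⟩

/-- In effect, x has at most one child: two children have vertices of the clique K below them, these
are comparable, and so the children are ancestors of a common vertex on the same level. -/
theorem IsElimTree.none_isAncestor_iff (hR : IsElimTree (addSimplicial G K) R)
    (hc : G.IsClique (K : Set V)) {c : V} (hch : R.IsChild (some c) none) (z : V) :
    R.IsAncestor none (some z) ↔ R.IsAncestor (some c) (some z) := by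
  refine ⟨fun h => ?_, fun h => hch.isAncestor.trans h⟩
  obtain ⟨d, hd, hdz⟩ := exists_isChild h (by simp)
  rcases d with _ | d
  · exact (hd.ne rfl).elim
  obtain ⟨u, hu, hcu⟩ := hR.exists_mem_of_isChild_none hch
  obtain ⟨w, hw, hdw⟩ := hR.exists_mem_of_isChild_none hd
  have hdepth : R.depth (some c) = R.depth (some d) := by rw [hch.depth_eq, hd.depth_eq]
  have huw : R.IsAncestor (some u) (some w) ∨ R.IsAncestor (some w) (some u) := by
    by_cases h : u = w
    · exact Or.inl (h ▸ IsAncestor.refl R _)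
    · exact hR.comparable _ _ (addSimplicial_adj_some.2 (hc hu hw h))
  rcases huw with h' | h'
  · rwa [eq_of_depth_eq (hcu.trans h') hdw hdepth]
  · rwa [eq_of_depth_eq hcu (hdw.trans h') hdepth]

theorem exists_isChild_none {z : V} (h : R.IsAncestor none (some z)) :
    ∃ c, R.IsChild (some c) none := by
  obtain ⟨d, hd, -⟩ := exists_isChild h (by simp)
  rcases d with _ | d
  · exact (hd.ne rfl).elim
  · exact ⟨d, hd⟩

/-- If x has a child, there is a vertex of K below it. If x is a leaf, its parent is adjacent to x,
hence in K. -/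
theorem IsElimTree.exists_mem_of_isAncestor_none (hR : IsElimTree (addSimplicial G K) R)
    {w : V} (hw : R.IsAncestor (some w) none) :
    ∃ u ∈ K, R.IsAncestor (some w) (some u) := by
  by_cases h : ∃ z, R.IsAncestor none (some z)
  · obtain ⟨z, hz⟩ := h
    obtain ⟨c, hch⟩ := exists_isChild_none hz
    obtain ⟨u, hu, hcu⟩ := hR.exists_mem_of_isChild_none hch
    exact ⟨u, hu, hw.trans (hch.isAncestor.trans hcu)⟩
  · push Not at h
    have hne : none ≠ R.root := ne_root_of_isAncestor hw (by simp)
    obtain ⟨y, hy, hadj⟩ := hR.exists_adj none hne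
    rcases y with _ | y
    · rcases hq : R.parent none with _ | q
      · exact (parent_ne hne hq).elim
      · rw [hq] at hadj
        refine ⟨q, hadj, ?_⟩
        rw [← hq]
        exact hw.isAncestor_parent (by simp)
    · exact (h y hy).elim

/-- Contracting the new vertex in a search tree on `G_K` gives a search tree on `G`. -/
theorem IsElimTree.exists_contraction [Finite V] (hR : IsElimTree (addSimplicial G K) R)
    (hc : G.IsClique (K : Set V)) (hK : K.Nonempty) :
    ∃ T : RootedTreeOn V, IsElimTree G T ∧
      ∀ w z, T.IsAncestor w z ↔ R.IsAncestor (some w) (some z) := by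
  have hroot : ∃ ρ : V, ∀ z, R.IsAncestor (some ρ) (some z) := by
    rcases h : R.root with _ | r
    · obtain ⟨k, hk⟩ := hK
      have hn : ∀ z : V, R.IsAncestor none (some z) := fun z => h ▸ R.root_isAncestor _
      obtain ⟨c, hch⟩ := exists_isChild_none (hn k)
      exact ⟨c, fun z => (hR.none_isAncestor_iff hc hch z).1 (hn z)⟩
    · exact ⟨r, fun z => h ▸ R.root_isAncestor _⟩
  obtain ⟨ρ, hρ⟩ := hroot
  obtain ⟨T, hTR⟩ := exists_isAncestor_iff (fun w z : V => R.IsAncestor (some w) (some z))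
    (fun u => IsAncestor.refl R _) (fun _ _ _ => IsAncestor.trans)
    (fun _ _ h h' => Option.some.inj (h.antisymm h')) (fun _ _ _ => isAncestor_total) ρ hρ
  refine ⟨T, ⟨fun u w hadj => ?_, fun w hw => ?_⟩, hTR⟩
  · rw [hTR, hTR]
    exact hR.comparable _ _ hadj
  · have hpw := (hTR _ _).1 (T.isAncestor_parent w)
    have hne : some (T.parent w) ≠ some w := by simpa using parent_ne hw
    have hwr := ne_root_of_isAncestor hpw hne
    have hpq := hpw.isAncestor_parent hne
    obtain ⟨y, hy, hadj⟩ := hR.exists_adj _ hwr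
    have h1 := R.isAncestor_parent (some w)
    have h2 := parent_ne hwr
    -- If x is the parent of w, then w is its only child and the new parent of w is the parent of x.
    -- Whenever x is the only witness of adjacency, the parent lies in K, and a vertex of K below w
    -- replaces x because K is a clique.
    rcases hq : R.parent (some w) with _ | q
    · rw [hq] at h1 hpq
      obtain ⟨c, hch⟩ := exists_isChild_none h1
      have hcw : c = w := by
        by_contra hcw
        have h3 := ((hR.none_isAncestor_iff hc hch w).1 h1).isAncestor_parent (by simpa using hcw)
        rw [hq] at h3
        exact hch.ne (hch.isAncestor.antisymm h3)
      subst hcw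
      have hnr : none ≠ R.root := ne_root_of_isAncestor hpq (by simp)
      have h3 := R.isAncestor_parent none
      have h4 := hpq.isAncestor_parent (by simp)
      obtain ⟨y', hy', hadj'⟩ := hR.exists_adj none hnr
      rcases hq' : R.parent none with _ | q
      · exact (parent_ne hnr hq').elim
      rw [hq'] at h3 h4 hadj'
      have hqc : q ≠ c := by
        rintro rfl
        exact hch.ne (hch.isAncestor.antisymm h3)
      have hqp : T.parent c = q := ((hTR _ _).2 h4).antisymm
        (((hTR _ _).2 (h3.trans h1)).isAncestor_parent hqc)
      subst hqp
      rcases y' with _ | z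
      · obtain ⟨u, hu, hcu⟩ := hR.exists_mem_of_isChild_none hch
        refine ⟨u, (hTR _ _).2 hcu, hc hadj' hu ?_⟩
        rintro e
        exact not_isAncestor_parent hw (e ▸ (hTR _ _).2 hcu)
      · exact ⟨z, (hTR _ _).2 ((hR.none_isAncestor_iff hc hch z).1 hy'), hadj'⟩
    · rw [hq] at h1 h2 hpq hadj
      have hqw : q ≠ w := by simpa using h2
      have hqp : T.parent w = q := ((hTR _ _).2 hpq).antisymm
        (((hTR _ _).2 h1).isAncestor_parent hqw)
      subst hqp
      rcases y with _ | z
      · obtain ⟨u, hu, hwu⟩ := hR.exists_mem_of_isAncestor_none hy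
        refine ⟨u, (hTR _ _).2 hwu, hc hadj hu ?_⟩
        rintro e
        exact not_isAncestor_parent hw (e ▸ (hTR _ _).2 hwu)
      · exact ⟨z, (hTR _ _).2 hy, hadj⟩

/-- Every search tree on `G_K` is an insertion into a search tree on `G`. -/
theorem IsElimTree.exists_eq_insertAbove [Finite V] (hR : IsElimTree (addSimplicial G K) R)
    (hc : G.IsClique (K : Set V)) (hK : K.Nonempty) :
    ∃ T : RootedTreeOn V, IsElimTree G T ∧ ∃ p, T.IsPlace (T.lowest K hK) p ∧
      R = T.insertAbove (T.lowest K hK) p := by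
  obtain ⟨T, hT, hTR⟩ := hR.exists_contraction hc hK
  refine ⟨T, hT, ?_⟩
  set v := T.lowest K hK with hv
  have hvK : v ∈ K := T.lowest_mem hK
  have heq : ∀ p, T.IsPlace v p →
      (∀ w, R.IsAncestor (some w) none ↔
        T.IsAncestor w v ∧ ∀ c, p = some c → T.IsAncestor w c ∧ w ≠ c) →
      (∀ z, R.IsAncestor none (some z) ↔ ∃ c, p = some c ∧ T.IsAncestor c z) →
      R = T.insertAbove v p := by
    intro p hp h1 h2
    refine eq_of_isAncestor_iff ?_
    rintro (_ | w) (_ | z)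
    · exact iff_of_true (IsAncestor.refl _ _) (IsAncestor.refl _ _)
    · rw [h2, insertAbove_none_some hp]
    · rw [h1, insertAbove_some_none hp]
    · rw [← hTR, insertAbove_some_some hp]
  by_cases h : ∃ z, R.IsAncestor none (some z)
  · obtain ⟨z, hz⟩ := h
    obtain ⟨c, hch⟩ := exists_isChild_none hz
    obtain ⟨u, hu, hcu⟩ := hR.exists_mem_of_isChild_none hch
    have hcv : T.IsAncestor c v := ((hTR _ _).2 hcu).trans (hT.isAncestor_lowest hK hc hu)
    refine ⟨some c, isPlace_some hcv, heq _ (isPlace_some hcv) (fun w => ?_) (fun z => ?_)⟩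
    · simp only [Option.some.injEq, forall_eq']
      constructor
      · intro hw
        have hwc := (hTR _ _).2 (hw.trans hch.isAncestor)
        refine ⟨hwc.trans hcv, hwc, ?_⟩
        rintro rfl
        exact hch.ne (hch.isAncestor.antisymm hw)
      · rintro ⟨-, h1, h2⟩
        exact hch.isAncestor_of_ne ((hTR _ _).1 h1) (by simpa using h2)
    · simp only [Option.some.injEq, exists_eq_left']
      rw [hR.none_isAncestor_iff hc hch, hTR]
  · push Not at h
    refine ⟨none, T.isPlace_none v, heq _ (T.isPlace_none v) (fun w => ?_) (fun z => ?_)⟩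
    · simp only [reduceCtorEq, false_imp_iff, implies_true, and_true]
      constructor
      · intro hw
        obtain ⟨u, hu, hwu⟩ := hR.exists_mem_of_isAncestor_none hw
        exact ((hTR _ _).2 hwu).trans (hT.isAncestor_lowest hK hc hu)
      · intro hw
        refine ((hTR _ _).1 hw).trans ?_
        -- Here x is a leaf, and its neighbour v can only be above it.
        rcases hR.comparable none (some v) hvK with h' | h'
        · exact (h v h').elim
        · exact h'
    · simp [h z]

end Contraction

end Insertion

/-! ### How levels, insertions and the lowest vertex of K behave under a flip -/

namespace RootedTreeOn

variable {V : Type*} {G : SimpleGraph V} {T T' : RootedTreeOn V} {a b v v' w : V}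

namespace IsFlip

section Depth

variable [Finite V]

theorem depth_eq_of_not (h : IsFlip T T' a b) (hT : IsElimTree G T) (hT' : IsElimTree G T')
    (hwa : w ≠ a) (hwb : w ≠ b) (hw : ¬ T.IsAncestor a w) : T'.depth w = T.depth w := by
  rw [depth_eq_ncard, depth_eq_ncard]
  congr 1
  ext u
  refine and_congr_left fun hu => ?_
  have hb : ¬ T'.IsAncestor b w := fun h' => hw ((h.top_iff hT hT' w).2 h')
  by_cases hua : u = a
  · subst hua
    exact iff_of_false (fun h' => hb (h.right.trans h')) hw
  by_cases hub : u = b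
  · subst hub
    exact iff_of_false hb fun h' => hw (h.left.trans h')
  exact (h.iff_of_ne u hua hub w).symm

/-- The strict ancestors of the upper vertex of the pair are the same in both trees. -/
theorem depth_right (h : IsFlip T T' a b) : T'.depth b = T.depth a := by
  rw [depth_eq_ncard, depth_eq_ncard]
  congr 1
  ext u
  by_cases hua : u = a
  · subst hua
    exact iff_of_false (fun h' => h.symm.not_left h'.1) fun h' => h'.2 rfl
  by_cases hub : u = b
  · subst hub
    exact iff_of_false (fun h' => h'.2 rfl) fun h' => h.not_left h'.1
  change T'.IsAncestor u b ∧ u ≠ b ↔ T.IsAncestor u a ∧ u ≠ a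
  rw [h.above_iff hua hub]
  simp [hua, hub]

theorem depth_eq_of_isAncestor (h : IsFlip T T' a b) (hwa : w ≠ a) (hwb : w ≠ b)
    (hw : T.IsAncestor b w) (hw' : T'.IsAncestor a w) : T'.depth w = T.depth w := by
  rw [depth_eq_ncard, depth_eq_ncard]
  congr 1
  ext u
  refine and_congr_left fun hu => ?_
  by_cases hua : u = a
  · subst hua
    exact iff_of_true hw' (h.left.trans hw)
  by_cases hub : u = b
  · subst hub
    exact iff_of_true (h.right.trans hw') hw
  exact (h.iff_of_ne u hua hub w).symm

/-- The vertex a is the one ancestor that w loses; this is the source of the shift from i + 1 to i.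
-/
theorem depth_eq_add_one (h : IsFlip T T' a b) (hT : IsElimTree G T) (hT' : IsElimTree G T')
    (hwa : w ≠ a) (hwb : w ≠ b) (hw : T.IsAncestor b w) (hw' : ¬ T'.IsAncestor a w) :
    T.depth w = T'.depth w + 1 := by
  rw [depth_eq_ncard T, depth_eq_ncard T', ← Set.ncard_insert_of_notMem (a := a)
    (fun h' => hw' h'.1)]
  congr 1
  ext u
  by_cases hua : u = a
  · subst hua
    exact iff_of_true ⟨h.left.trans hw, hwa.symm⟩ (Or.inl rfl)
  rw [Set.mem_insert_iff, or_iff_right hua]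
  refine and_congr_left fun hu => ?_
  by_cases hub : u = b
  · subst hub
    exact iff_of_true hw ((h.top_iff hT hT' w).1 (h.left.trans hw))
  exact h.iff_of_ne u hua hub w

end Depth

section Insertion

variable {p p' : Option V}

/-- A flip lifts as soon as x has the same descendants in both insertions and, apart from a and b,
the same ancestors. -/
theorem insertAbove (h : IsFlip T T' a b) (hp : T.IsPlace v p) (hp' : T'.IsPlace v' p')
    (hbelow : ∀ z, (∃ c, p = some c ∧ T.IsAncestor c z) ↔
      ∃ c, p' = some c ∧ T'.IsAncestor c z)
    (habove : ∀ w, w ≠ a → w ≠ b →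
      (T.IsAncestor w v ∧ (∀ c, p = some c → T.IsAncestor w c ∧ w ≠ c) ↔
        T'.IsAncestor w v' ∧ ∀ c, p' = some c → T'.IsAncestor w c ∧ w ≠ c)) :
    IsFlip (T.insertAbove v p) (T'.insertAbove v' p') (some a) (some b) := by
  refine ⟨by simpa using h.ne, ?_, (insertAbove_some_some hp).2 h.left,
    (insertAbove_some_some hp').2 h.right⟩
  rintro (_ | w) hwa hwb (_ | z)
  · exact iff_of_true (IsAncestor.refl _ _) (IsAncestor.refl _ _)
  · rw [insertAbove_none_some hp, insertAbove_none_some hp', hbelow]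
  · rw [insertAbove_some_none hp, insertAbove_some_none hp']
    exact habove w (by simpa using hwa) (by simpa using hwb)
  · rw [insertAbove_some_some hp, insertAbove_some_some hp']
    exact h.iff_of_ne w (by simpa using hwa) (by simpa using hwb) z

theorem insertAt_of_ne {c : V} (h : IsFlip T T' a b) (hca : c ≠ a) (hcb : c ≠ b)
    (hc : T.IsAncestor c v) (hc' : T'.IsAncestor c v') :
    IsFlip (T.insertAt (T.depth c) v) (T'.insertAt (T'.depth c) v') (some a) (some b) := by
  refine h.insertAbove (isPlace_some hc) (isPlace_some hc') (fun z => ?_) (fun w hwa hwb => ?_)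
  · simp only [Option.some.injEq, exists_eq_left']
    exact h.iff_of_ne c hca hcb z
  · simp only [Option.some.injEq, forall_eq']
    rw [h.iff_of_ne w hwa hwb c]
    constructor
    · rintro ⟨-, h1, h2⟩
      exact ⟨h1.trans hc', h1, h2⟩
    · rintro ⟨-, h1, h2⟩
      exact ⟨((h.iff_of_ne w hwa hwb c).2 h1).trans hc, h1, h2⟩

/-- The slot above a in `T` corresponds to the slot above b in `T'`, since both subtrees have the
same vertices. -/
theorem insertAt_top (h : IsFlip T T' a b) (hT : IsElimTree G T) (hT' : IsElimTree G T')
    (ha : T.IsAncestor a v) (hb : T'.IsAncestor b v') :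
    IsFlip (T.insertAt (T.depth a) v) (T'.insertAt (T'.depth b) v') (some a) (some b) := by
  refine h.insertAbove (isPlace_some ha) (isPlace_some hb) (fun z => ?_) (fun w hwa hwb => ?_)
  · simp only [Option.some.injEq, exists_eq_left']
    exact h.top_iff hT hT' z
  · simp only [Option.some.injEq, forall_eq']
    have hiff := h.above_iff hwa hwb
    constructor
    · rintro ⟨-, h1, h2⟩
      exact ⟨(hiff.1 h1).trans hb, hiff.1 h1, hwb⟩
    · rintro ⟨-, h1, h2⟩
      exact ⟨(hiff.2 h1).trans ha, hiff.2 h1, hwa⟩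

theorem insertAt_bottom (h : IsFlip T T' a b)
    (hv : ∀ w, w ≠ a → w ≠ b → (T.IsAncestor w v ↔ T'.IsAncestor w v')) :
    IsFlip (T.insertAt (T.depth v + 1) v) (T'.insertAt (T'.depth v' + 1) v')
      (some a) (some b) := by
  refine h.insertAbove (isPlace_none T v) (isPlace_none T' v') (fun z => by simp)
    (fun w hwa hwb => ?_)
  simpa using hv w hwa hwb

theorem of_insertAbove (h : IsFlip (T.insertAbove v p) (T'.insertAbove v' p') (some a) (some b))
    (hp : T.IsPlace v p) (hp' : T'.IsPlace v' p') : IsFlip T T' a b := by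
  refine ⟨by simpa using h.ne, fun w hwa hwb z => ?_, (insertAbove_some_some hp).1 h.left,
    (insertAbove_some_some hp').1 h.right⟩
  rw [← insertAbove_some_some hp, ← insertAbove_some_some hp']
  exact h.iff_of_ne (some w) (by simpa using hwa) (by simpa using hwb) (some z)

end Insertion

section Lowest

variable {K : Finset V} (hK : K.Nonempty)

theorem lowest_eq_of_ne (h : IsFlip T T' a b) (hT : IsElimTree G T) (hT' : IsElimTree G T')
    (hc : G.IsClique (K : Set V)) (ha : T.lowest K hK ≠ a) (hb : T.lowest K hK ≠ b) :
    T'.lowest K hK = T.lowest K hK := by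
  refine hT'.eq_lowest hK hc (T.lowest_mem hK) fun w hw => ?_
  rcases hT'.comparable_of_mem hc hw (T.lowest_mem hK) with h' | h'
  · exact h'
  · rw [← ((h.iff_of_ne _ ha hb w).2 h').antisymm (hT.isAncestor_lowest hK hc hw)]
    exact IsAncestor.refl T' _

theorem lowest_eq_of_mem (h : IsFlip T T' a b) (hT : IsElimTree G T) (hT' : IsElimTree G T')
    (hc : G.IsClique (K : Set V)) (hb : b = T.lowest K hK) (ha : a ∈ K) :
    T'.lowest K hK = a := by
  refine hT'.eq_lowest hK hc ha fun w hw => ?_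
  by_cases hwa : w = a
  · exact hwa ▸ IsAncestor.refl T' w
  by_cases hwb : w = b
  · exact hwb ▸ h.right
  have hw' := hT.isAncestor_lowest hK hc hw
  rw [← hb, h.iff_of_ne w hwa hwb] at hw'
  exact hw'.trans h.right

theorem lowest_eq_of_not_mem (h : IsFlip T T' a b) (hT : IsElimTree G T) (hT' : IsElimTree G T')
    (hc : G.IsClique (K : Set V)) (hb : b = T.lowest K hK) (ha : a ∉ K) :
    T'.lowest K hK = b := by
  refine hT'.eq_lowest hK hc (hb ▸ T.lowest_mem hK) fun w hw => ?_
  have hwa : w ≠ a := fun e => ha (e ▸ hw)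
  by_cases hwb : w = b
  · exact hwb ▸ IsAncestor.refl T' w
  have hw' := hT.isAncestor_lowest hK hc hw
  rwa [← hb, h.iff_of_ne w hwa hwb] at hw'

/-- In the case without listed pairs, a on the path and b off it, the inverse rotation satisfies the
path condition of `IsFlip.epsIndex`. -/
theorem isAncestor_lowest_of_not (h : IsFlip T T' a b) (hT : IsElimTree G T)
    (hT' : IsElimTree G T') (hc : G.IsClique (K : Set V)) (ha : T.IsAncestor a (T.lowest K hK))
    (hb : ¬ T.IsAncestor b (T.lowest K hK)) : T'.IsAncestor a (T'.lowest K hK) := by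
  by_cases hav : a = T.lowest K hK
  · rw [hT'.eq_lowest hK hc (u := a) (hav ▸ T.lowest_mem hK) fun w hw => ?_]
    · exact IsAncestor.refl T' a
    · by_cases hwa : w = a
      · exact hwa ▸ IsAncestor.refl T' w
      · have hw' := hT.isAncestor_lowest hK hc hw
        have hwb : w ≠ b := fun e => hb (e ▸ hw')
        rwa [← hav, h.iff_of_ne w hwa hwb] at hw'
  · obtain ⟨c, hch, hcv⟩ := exists_isChild ha hav
    have hcb : c ≠ b := fun e => hb (e ▸ hcv)
    rw [h.iff_of_ne c hch.ne.symm hcb] at hcv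
    exact ((h.isAncestor_child_left hT hT' hch hcb).trans hcv).trans
      (hT'.isAncestor_lowest hK hc (T.lowest_mem hK))

/-- The case distinction for ε asks whether the branch towards v moves below a, that is, whether v
keeps a as an ancestor. -/
theorem exists_adj_iff (h : IsFlip T T' a b) (hT' : IsElimTree G T')
    (hva : v ≠ a) (hb : T.IsAncestor b v) (hvb : b ≠ v) :
    (∃ c, T.IsChild c b ∧ T.IsAncestor c v ∧ ∃ z, T.IsAncestor c z ∧ G.Adj a z) ↔
      T'.IsAncestor a v := by
  have hca : ∀ c, T.IsChild c b → c ≠ a := by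
    rintro c hc rfl
    exact h.not_left hc.isAncestor
  constructor
  · rintro ⟨c, hc, hcv, hz⟩
    exact ((h.isAncestor_child_right_iff hT' hc).2 hz).trans
      ((h.iff_of_ne c (hca c hc) hc.ne.symm v).1 hcv)
  · intro hav
    obtain ⟨c, hc, hcv⟩ := exists_isChild hb hvb
    refine ⟨c, hc, hcv, (h.isAncestor_child_right_iff hT' hc).1 ?_⟩
    have hiff := h.iff_of_ne c (hca c hc) hc.ne.symm
    rcases isAncestor_total hav ((hiff v).1 hcv) with h' | h'
    · exact h'
    · exact (hc.ne (hc.isAncestor.antisymm (((hiff a).2 h').trans h.left))).elim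

end Lowest

end IsFlip

/-! ### The pairs described by a rotation -/

section EpsIndex

variable {K : Finset V} {hK : K.Nonempty} {i j : ℕ}

/-- Insertions above vertices `c` that lie above the lower vertex `b` of the rotated edge. -/
theorem IsFlip.insertAt_of_lt [Finite V] (h : IsFlip T T' a b) (hT : IsElimTree G T) (hT' : IsElimTree G T')
    (hb : T.IsAncestor b v) (hb' : T'.IsAncestor b v') (hi : i < T.depth b) :
    IsFlip (T.insertAt i v) (T'.insertAt i v') (some a) (some b) ∧ i ≤ T'.depth v' + 1 := by
  have hiv : i ≤ T.depth v := hi.le.trans hb.depth_le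
  have hdb : T'.depth b = T.depth a := h.depth_right
  have hda := h.isChild.depth_eq
  have hbv := hb'.depth_le
  refine ⟨?_, by omega⟩
  set c := T.pathVertex v i with hc
  have hcv : T.IsAncestor c v := T.pathVertex_isAncestor v i
  have hdc : T.depth c = i := T.depth_pathVertex v hiv
  have hcb : T.IsAncestor c b := by
    rcases isAncestor_total hcv hb with h' | h'
    · exact h'
    · exact absurd h'.depth_le (by omega)
  have hne : c ≠ b := by
    intro e
    rw [e] at hdc
    omega
  have hca := h.isAncestor_right_of_ne hne hcb
  by_cases hcea : c = a
  · have h1 := h.insertAt_top hT hT' (h.left.trans hb) hb'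
    -- The slot above a becomes the slot above b, with the same index.
    rwa [hdb, show T.depth a = i from hcea ▸ hdc] at h1
  · have hac : ¬ T.IsAncestor a c := fun h' => hcea (hca.antisymm h')
    have h1 := h.insertAt_of_ne hcea hne hcv
      (((h.iff_of_ne c hcea hne b).1 hcb).trans hb')
    rwa [h.depth_eq_of_not hT hT' hcea hne hac, hdc] at h1

/-- The slot above a third vertex c goes to the slot above c, the slot above a to the slot above b,
and the bottom to the bottom. The change in the level of c, or of the lowest vertex, gives j. -/
theorem EpsIndex.isFlip [Finite V] (he : EpsIndex G K hK T a b i j) (h : IsFlip T T' a b)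
    (hT : IsElimTree G T) (hT' : IsElimTree G T') (hc : G.IsClique (K : Set V)) :
    i ≤ T.maxLevel K + 1 ∧ j ≤ T'.maxLevel K + 1 ∧
      IsFlip (T.insertLowest K hK i) (T'.insertLowest K hK j) (some a) (some b) := by
  simp only [insertLowest, maxLevel_eq hK]
  have hda := h.isChild.depth_eq
  set v := T.lowest K hK with hv
  cases he with
  | off_path _ ha hb hi =>
    rw [maxLevel_eq hK, ← hv] at hi
    have hva : v ≠ a := fun e => ha (e ▸ IsAncestor.refl T v)
    have hvb : v ≠ b := fun e => hb (e ▸ IsAncestor.refl T v)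
    rw [h.lowest_eq_of_ne hK hT hT' hc hva hvb, ← hv]
    have hd := h.depth_eq_of_not hT hT' hva hvb ha
    refine ⟨hi, by omega, ?_⟩
    obtain ⟨p, hp, rfl⟩ := exists_isPlace hi
    rcases p with _ | c
    · have h1 := h.insertAt_bottom fun w hwa hwb => h.iff_of_ne w hwa hwb v
      rwa [hd] at h1
    · have hcv := hp c rfl
      have hca : c ≠ a := fun e => ha (e ▸ hcv)
      have hcb : c ≠ b := fun e => hb (e ▸ hcv)
      have h1 := h.insertAt_of_ne hca hcb hcv ((h.iff_of_ne c hca hcb v).1 hcv)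
      rwa [h.depth_eq_of_not hT hT' hca hcb fun h' => ha (h'.trans hcv)] at h1
  | on_path_adj _ ha hb hne hS hi hil =>
    rw [maxLevel_eq hK, ← hv] at hi
    rw [← hv] at ha hb hne hS
    have hva : v ≠ a := fun e => h.not_left (e ▸ hb)
    rw [h.exists_adj_iff hT' hva hb hne] at hS
    rw [h.lowest_eq_of_ne hK hT hT' hc hva hne.symm, ← hv]
    have hd := h.depth_eq_of_isAncestor hva hne.symm hb hS
    refine ⟨hi, by omega, ?_⟩
    rcases lt_or_gt_of_ne hil with hlt | hgt
    · exact (h.insertAt_of_lt hT hT' hb (h.right.trans hS) hlt).1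
    obtain ⟨p, hp, rfl⟩ := exists_isPlace hi
    rcases p with _ | c
    · have h1 := h.insertAt_bottom fun w hwa hwb => h.iff_of_ne w hwa hwb v
      rwa [hd] at h1
    · have hcv := hp c rfl
      change T.depth b < T.depth c at hgt
      have hbc : T.IsAncestor b c := by
        rcases isAncestor_total hb hcv with h' | h'
        · exact h'
        · exact absurd h'.depth_le (by omega)
      have hcb : c ≠ b := by
        rintro rfl
        exact hgt.ne rfl
      have hca : c ≠ a := by
        rintro rfl
        exact h.not_left hbc
      have hiff := h.iff_of_ne c hca hcb
      have hac : T'.IsAncestor a c := by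
        rcases isAncestor_total hS ((hiff v).1 hcv) with h' | h'
        · exact h'
        · exact (h.not_left (hbc.trans ((hiff a).2 h'))).elim
      have h1 := h.insertAt_of_ne hca hcb hcv ((hiff v).1 hcv)
      rwa [h.depth_eq_of_isAncestor hca hcb hbc hac] at h1
  | on_path_not_adj_above _ ha hb hne hS hi =>
    rw [← hv] at ha hb hne hS
    have hva : v ≠ a := fun e => h.not_left (e ▸ hb)
    rw [h.lowest_eq_of_ne hK hT hT' hc hva hne.symm, ← hv]
    obtain ⟨h1, h2⟩ := h.insertAt_of_lt hT hT' hb ((h.top_iff hT hT' v).1 ha) hi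
    have := hb.depth_le
    exact ⟨by omega, h2, h1⟩
  | on_path_not_adj_below _ ha hb hne hS hi hik =>
    rw [maxLevel_eq hK, ← hv] at hik
    rw [← hv] at ha hb hne hS
    have hva : v ≠ a := fun e => h.not_left (e ▸ hb)
    rw [h.exists_adj_iff hT' hva hb hne] at hS
    rw [h.lowest_eq_of_ne hK hT hT' hc hva hne.symm, ← hv]
    have hd := h.depth_eq_add_one hT hT' hva hne.symm hb hS
    refine ⟨by omega, by omega, ?_⟩
    obtain ⟨p, hp, hpi⟩ := exists_isPlace (T := T) (v := v) (i := j + 1) (by omega)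
    rcases p with _ | c
    · have h1 := h.insertAt_bottom fun w hwa hwb => h.iff_of_ne w hwa hwb v
      rwa [← hd, show T.depth v = j from Nat.succ.inj hpi] at h1
    · have hcv := hp c rfl
      change T.depth c = j + 1 at hpi
      have hbc : T.IsAncestor b c := by
        rcases isAncestor_total hb hcv with h' | h'
        · exact h'
        · exact absurd h'.depth_le (by omega)
      have hcb : c ≠ b := by
        rintro rfl
        omega
      have hca : c ≠ a := by
        rintro rfl
        exact h.not_left hbc
      have hcv' := (h.iff_of_ne c hca hcb v).1 hcv
      have h1 := h.insertAt_of_ne hca hcb hcv hcv'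
      have h2 := h.depth_eq_add_one hT hT' hca hcb hbc fun h' => hS (h'.trans hcv')
      rwa [show T'.depth c = j by omega, hpi] at h1
  | lowest_above _ hb hi =>
    rw [maxLevel_eq hK, ← hb] at hi
    have hb' : T'.IsAncestor b (T'.lowest K hK) := by
      by_cases ha : a ∈ K
      · rw [h.lowest_eq_of_mem hK hT hT' hc hb ha]
        exact h.right
      · rw [h.lowest_eq_of_not_mem hK hT hT' hc hb ha]
        exact IsAncestor.refl T' b
    rw [← hv] at hb
    rw [← hb]
    obtain ⟨h1, h2⟩ := h.insertAt_of_lt hT hT' (IsAncestor.refl T b) hb' hi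
    exact ⟨by omega, h2, h1⟩
  | lowest_mem hb ha =>
    rw [maxLevel_eq hK, h.lowest_eq_of_mem hK hT hT' hc hb ha, ← hb]
    rw [← hv] at hb
    rw [← hb]
    have hd := h.symm.isChild.depth_eq
    rw [h.depth_right, ← hda] at hd
    refine ⟨le_rfl, by omega, ?_⟩
    -- The lowest vertex of K changes from b to a, whose new level is the old level of b, so the
    -- bottom index stays k + 1.
    have h1 := h.insertAt_bottom (v := b) (v' := a) fun w hwa hwb => by
      rw [h.iff_of_ne w hwa hwb b, h.symm.above_iff hwb hwa, h.iff_of_ne w hwa hwb a]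
    rwa [hd] at h1
  | lowest_not_mem hb ha =>
    rw [maxLevel_eq hK, h.lowest_eq_of_not_mem hK hT hT' hc hb ha, ← hb]
    rw [← hv] at hb
    rw [← hb]
    have hd := h.depth_right
    refine ⟨le_rfl, by omega, ?_⟩
    -- The lowest vertex stays b but rises to level k - 1, so the bottom index drops to k.
    have h1 := h.insertAt_bottom (v := b) (v' := b) fun w hwa hwb => h.iff_of_ne w hwa hwb b
    rwa [hd, ← hda] at h1

theorem exists_epsIndex (hab : T.IsAncestor a b)
    (hA : T.IsAncestor a (T.lowest K hK) → T.IsAncestor b (T.lowest K hK))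
    (hi : i ≤ T.maxLevel K + 1) (hib : T.IsAncestor b (T.lowest K hK) → i ≠ T.depth b) :
    ∃ j, EpsIndex G K hK T a b i j := by
  by_cases ha : T.IsAncestor a (T.lowest K hK)
  · have hb := hA ha
    have hib := hib hb
    by_cases hbv : b = T.lowest K hK
    · by_cases hik : i < T.maxLevel K
      · exact ⟨i, .lowest_above i hbv hik⟩
      · have hm := maxLevel_eq hK T
        rw [← hbv] at hm
        obtain rfl : i = T.maxLevel K + 1 := by omega
        by_cases haK : a ∈ K
        · exact ⟨_, .lowest_mem hbv haK⟩
        · exact ⟨_, .lowest_not_mem hbv haK⟩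
    · by_cases hS : ∃ c, T.IsChild c b ∧ T.IsAncestor c (T.lowest K hK) ∧
        ∃ z, T.IsAncestor c z ∧ G.Adj a z
      · exact ⟨i, .on_path_adj i ha hb hbv hS hi hib⟩
      · by_cases hlt : i < T.depth b
        · exact ⟨i, .on_path_not_adj_above i ha hb hbv hS hlt⟩
        · obtain ⟨i, rfl⟩ : ∃ i', i = i' + 1 := ⟨i - 1, by omega⟩
          exact ⟨i, .on_path_not_adj_below i ha hb hbv hS (by omega) (by omega)⟩
  · exact ⟨i, .off_path i ha (fun hb => ha (hab.trans hb)) hi⟩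

/-- Some j' is listed with i, and `EpsIndex.isFlip` makes T(i), T'(j') a flip of the same pair. Both
T'(j) and T'(j') have the same vertices below x as T(i), hence j = j'. -/
theorem IsFlip.epsIndex [Finite V] (hc : G.IsClique (K : Set V)) (hT : IsElimTree G T)
    (hT' : IsElimTree G T') (hi : i ≤ T.maxLevel K + 1) (hj : j ≤ T'.maxLevel K + 1)
    (hR : IsFlip (T.insertLowest K hK i) (T'.insertLowest K hK j) (some a) (some b))
    (hA : T.IsAncestor a (T.lowest K hK) → T.IsAncestor b (T.lowest K hK)) :
    EpsIndex G K hK T a b i j := by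
  rw [maxLevel_eq hK] at hj
  have hi' := hi
  rw [maxLevel_eq hK] at hi'
  obtain ⟨p, hp, hpi⟩ := exists_isPlace hi'
  obtain ⟨p', hp', hpj⟩ := exists_isPlace hj
  have eR : T.insertLowest K hK i = T.insertAbove (T.lowest K hK) p := by rw [RootedTreeOn.insertAbove, hpi, insertLowest]
  have eR' : T'.insertLowest K hK j = T'.insertAbove (T'.lowest K hK) p' := by
    rw [RootedTreeOn.insertAbove, hpj, insertLowest]
  have h : IsFlip T T' a b := by
    rw [eR, eR'] at hR
    exact hR.of_insertAbove hp hp'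
  obtain ⟨j', he⟩ := exists_epsIndex (G := G) h.left hA hi (by
    -- If x sat between a and b, it would be above b in both trees, hence above a in T'(j), hence
    -- above a in T(i), which puts b above a in `T`.
    rintro hb rfl
    have hpb : p = some b := by
      rcases p with _ | c
      · have := hb.depth_le
        change T.depth _ + 1 = _ at hpi
        omega
      · rw [eq_of_depth_eq (hp c rfl) hb hpi]
    have h1 : (T.insertLowest K hK (T.depth b)).IsAncestor none (some b) := by
      rw [eR, insertAbove_none_some hp]
      exact ⟨b, hpb, IsAncestor.refl T b⟩
    have h2 := (hR.iff_of_ne none (by simp) (by simp) (some a)).2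
      (((hR.iff_of_ne none (by simp) (by simp) (some b)).1 h1).trans hR.right)
    rw [eR, insertAbove_none_some hp, hpb] at h2
    obtain ⟨_, ⟨⟩, h3⟩ := h2
    exact h.not_left h3)
  obtain ⟨-, hj', hR'⟩ := he.isFlip h hT hT' hc
  rw [maxLevel_eq hK] at hj'
  obtain ⟨q, hq, hqj⟩ := exists_isPlace hj'
  have eR'' : T'.insertLowest K hK j' = T'.insertAbove (T'.lowest K hK) q := by
    rw [RootedTreeOn.insertAbove, hqj, insertLowest]
  have hpq : q = p' := place_eq_of_none_iff hq hp' fun z => by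
    rw [← eR', ← eR'', ← hR.iff_of_ne none (by simp) (by simp),
      ← hR'.iff_of_ne none (by simp) (by simp)]
  rwa [← hpj, ← hpq, hqj]

end EpsIndex

end RootedTreeOn

open RootedTreeOn

/-! ### Blocks and rotations that involve x -/

section Blocks

variable {V : Type*} {G : SimpleGraph V} {T T' : RootedTreeOn V} {K : Finset V} {hK : K.Nonempty}
  {i j : ℕ}

theorem exists_insertLowest_eq (hi : i ≤ T.maxLevel K + 1) :
    ∃ p, T.IsPlace (T.lowest K hK) p ∧ T.insertIndex (T.lowest K hK) p = i ∧
      T.insertLowest K hK i = T.insertAbove (T.lowest K hK) p := by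
  rw [maxLevel_eq hK] at hi
  obtain ⟨p, hp, rfl⟩ := exists_isPlace hi
  exact ⟨p, hp, rfl, rfl⟩

theorem IsElimTree.insertLowest (hT : IsElimTree G T) (hc : G.IsClique (K : Set V))
    (hi : i ≤ T.maxLevel K + 1) : IsElimTree (addSimplicial G K) (T.insertLowest K hK i) := by
  obtain ⟨p, hp, -, h⟩ := exists_insertLowest_eq (hK := hK) hi
  rw [h]
  exact hT.insertAbove hK hc hp

theorem eq_of_insertLowest_eq (hi : i ≤ T.maxLevel K + 1) (hj : j ≤ T'.maxLevel K + 1)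
    (h : T.insertLowest K hK i = T'.insertLowest K hK j) : T = T' ∧ i = j := by
  obtain ⟨p, hp, hpi, h1⟩ := exists_insertLowest_eq (hK := hK) hi
  obtain ⟨q, hq, hqj, h2⟩ := exists_insertLowest_eq (hK := hK) hj
  rw [h1, h2] at h
  obtain rfl := eq_of_insertAbove_eq hp hq h
  refine ⟨rfl, ?_⟩
  rw [← hpi, ← hqj, place_eq_of_none_iff hp hq fun z => by rw [h]]

/-- Moving the new vertex down by one step is a rotation. -/
theorem insertLowest_succ_isFlip (hi : i ≤ T.maxLevel K) :
    ∃ a, IsFlip (T.insertLowest K hK (i + 1)) (T.insertLowest K hK i) (some a) none := by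
  have hi' := hi
  rw [maxLevel_eq hK] at hi'
  have hi1 : i ≤ T.depth (T.lowest K hK) + 1 := by omega
  have hi2 : i + 1 ≤ T.depth (T.lowest K hK) + 1 := by omega
  have hd := T.depth_pathVertex _ hi'
  refine ⟨T.pathVertex (T.lowest K hK) i, by simp, ?_, ?_, ?_⟩
  · rintro (_ | w) hwa hwn (_ | z)
    · exact absurd rfl hwn
    · exact absurd rfl hwn
    · simp only [insertLowest, insertAt_isAncestor_some hi1, insertAt_isAncestor_some hi2,
        Option.elim_none]
      refine and_congr_right fun hw => ?_
      have hne : T.depth w ≠ i := by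
        rintro rfl
        exact hwa (by rw [pathVertex_depth hw])
      omega
    · simp only [insertLowest, insertAt_isAncestor_some hi1, insertAt_isAncestor_some hi2,
        Option.elim_some]
  · simp only [insertLowest, insertAt_isAncestor_some hi2, Option.elim_none]
    exact ⟨T.pathVertex_isAncestor _ i, by omega⟩
  · simp only [insertLowest, insertAt_none_isAncestor, Option.elim_some]
    exact ⟨hi', IsAncestor.refl T _⟩

/-- Exchanging a with x leaves x directly above a. The order on the old vertices survives, because
the descendants of a in T(i) are those of x in T'(j). -/
theorem RootedTreeOn.IsFlip.eq_of_none {a : V} (hT : IsElimTree G T) (hT' : IsElimTree G T')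
    (hc : G.IsClique (K : Set V)) (hi : i ≤ T.maxLevel K + 1) (hj : j ≤ T'.maxLevel K + 1)
    (h : IsFlip (T.insertLowest K hK i) (T'.insertLowest K hK j) (some a) none) :
    T = T' ∧ i = j + 1 := by
  have hR := hT.insertLowest (hK := hK) hc hi
  have hR' := hT'.insertLowest (hK := hK) hc hj
  obtain ⟨p, hp, hpi, h1⟩ := exists_insertLowest_eq (hK := hK) hi
  obtain ⟨q, hq, hqj, h2⟩ := exists_insertLowest_eq (hK := hK) hj
  have hch := h.isChild
  have hqa : q = some a := by
    have h3 := h.right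
    rw [h2, insertAbove_none_some hq] at h3
    obtain ⟨c, rfl, hca⟩ := h3
    by_contra hne
    have hne : some c ≠ some a := hne
    have h3 : (T'.insertLowest K hK j).IsAncestor (some c) none := by
      refine h.symm.isAncestor_right_of_ne hne ?_
      rw [h2, insertAbove_some_some hq]
      exact hca
    rw [h2, insertAbove_some_none hq] at h3
    exact (h3.2 c rfl).2 rfl
  have hTT : T = T' := by
    refine eq_of_isAncestor_iff fun w z => ?_
    by_cases hwa : w = a
    · subst hwa
      have h3 := h.top_iff hR hR' (some z)
      rw [h1, h2, insertAbove_some_some hp, insertAbove_none_some hq, hqa] at h3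
      simpa using h3
    · have h3 := h.iff_of_ne (some w) (by simpa using hwa) (by simp) (some z)
      rwa [h1, h2, insertAbove_some_some hp, insertAbove_some_some hq] at h3
  subst hTT
  refine ⟨rfl, ?_⟩
  -- In T(i) the parent of x is a, so a has level i - 1, while in T'(j) the slot above a has as
  -- index j the level of a.
  have h3 := hch.2
  rw [RootedTreeOn.insertLowest, insertAt_parent_none] at h3
  split_ifs at h3 with h0
  rw [maxLevel_eq hK] at hi
  have hd := T.depth_pathVertex (T.lowest K hK) (j := i - 1) (by omega)
  rw [Option.some.inj h3] at hd
  rw [hqa] at hqj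
  change T.depth a = j at hqj
  omega

/-- Adjacent insertions either lie in one block, next to each other, or come from a rotation of
the original tree. -/
theorem RootedTreeOn.IsFlip.insertLowest_cases {α β : Option V} (hT : IsElimTree G T)
    (hT' : IsElimTree G T') (hc : G.IsClique (K : Set V)) (hi : i ≤ T.maxLevel K + 1)
    (hj : j ≤ T'.maxLevel K + 1)
    (h : IsFlip (T.insertLowest K hK i) (T'.insertLowest K hK j) α β) :
    (T = T' ∧ (i = j + 1 ∨ j = i + 1)) ∨ ∃ a b, α = some a ∧ β = some b ∧ IsFlip T T' a b := by
  rcases α with _ | a <;> rcases β with _ | b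
  · exact absurd rfl h.ne
  · obtain ⟨rfl, h'⟩ := h.symm.eq_of_none hT' hT hc hj hi
    exact Or.inl ⟨rfl, Or.inr h'⟩
  · obtain ⟨rfl, h'⟩ := h.eq_of_none hT hT' hc hi hj
    exact Or.inl ⟨rfl, Or.inl h'⟩
  · obtain ⟨p, hp, -, h1⟩ := exists_insertLowest_eq (hK := hK) hi
    obtain ⟨q, hq, -, h2⟩ := exists_insertLowest_eq (hK := hK) hj
    rw [h1, h2] at h
    exact Or.inr ⟨a, b, rfl, rfl, h.of_insertAbove hp hq⟩

theorem eq_of_mem_insertionBlock {T T' : SearchTree G} {R : SearchTree (addSimplicial G K)}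
    (h : R ∈ insertionBlock K hK T) (h' : R ∈ insertionBlock K hK T') : T = T' := by
  obtain ⟨i, hi, hR⟩ := h
  obtain ⟨j, hj, hR'⟩ := h'
  exact Subtype.ext (eq_of_insertLowest_eq hi hj (hR.symm.trans hR')).1

end Blocks

/-! ### The rotation graph of G_K -/

section Rotations

variable {V : Type*} [Finite V] {G : SimpleGraph V} {K : Finset V} {hK : K.Nonempty}

theorem insertLowest_adj_iff (hG : G.Connected) (hc : G.IsClique (K : Set V)) {T : SearchTree G}
    {i j : ℕ} (hi : i ≤ T.1.maxLevel K + 1) (hj : j ≤ T.1.maxLevel K + 1)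
    {R R' : SearchTree (addSimplicial G K)} (hR : R.1 = T.1.insertLowest K hK i)
    (hR' : R'.1 = T.1.insertLowest K hK j) :
    (rotationGraph (addSimplicial G K)).Adj R R' ↔ i + 1 = j ∨ j + 1 = i := by
  have hT := (isSearchTree_iff hG).1 T.2
  rw [rotationGraph_adj_iff (addSimplicial_connected hG hK), hR, hR']
  constructor
  · rintro ⟨α, β, h⟩
    rcases h.insertLowest_cases hT hT hc hi hj with ⟨-, h | h⟩ | ⟨a, b, -, -, h⟩
    · exact Or.inr h.symm
    · exact Or.inl h.symm
    · exact absurd rfl h.trees_ne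
  · rintro (rfl | rfl)
    · obtain ⟨a, ha⟩ := insertLowest_succ_isFlip (T := T.1) (hK := hK) (Nat.le_of_succ_le_succ hj)
      exact ⟨_, _, ha.symm⟩
    · obtain ⟨a, ha⟩ := insertLowest_succ_isFlip (T := T.1) (hK := hK) (Nat.le_of_succ_le_succ hi)
      exact ⟨_, _, ha⟩

theorem exists_mem_insertionBlock (hG : G.Connected) (hc : G.IsClique (K : Set V))
    (R : SearchTree (addSimplicial G K)) : ∃ T : SearchTree G, R ∈ insertionBlock K hK T := by
  have hR := (isSearchTree_iff (addSimplicial_connected hG hK)).1 R.2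
  obtain ⟨T, hT, p, hp, h⟩ := hR.exists_eq_insertAbove hc hK
  refine ⟨⟨T, (isSearchTree_iff hG).2 hT⟩, _, ?_, h⟩
  rw [maxLevel_eq hK]
  exact hp.insertIndex_le

theorem insertLowest_isSearchTree (hG : G.Connected) (hc : G.IsClique (K : Set V))
    (T : SearchTree G) {i : ℕ} (hi : i ≤ T.1.maxLevel K + 1) :
    IsSearchTree (addSimplicial G K) (T.1.insertLowest K hK i) :=
  (isSearchTree_iff (addSimplicial_connected hG hK)).2
    (((isSearchTree_iff hG).1 T.2).insertLowest hc hi)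

theorem insertionBlock_nonempty (hG : G.Connected) (hc : G.IsClique (K : Set V))
    (T : SearchTree G) : (insertionBlock K hK T).Nonempty :=
  ⟨⟨_, insertLowest_isSearchTree hG hc T (Nat.zero_le _)⟩, 0, Nat.zero_le _, rfl⟩

theorem exists_pathGraph_iso (hG : G.Connected) (hc : G.IsClique (K : Set V))
    (T : SearchTree G) :
    ∃ φ : SimpleGraph.pathGraph (T.1.maxLevel K + 2) ≃g
        (rotationGraph (addSimplicial G K)).induce (insertionBlock K hK T),
      ∀ i, (φ i).1.1 = T.1.insertLowest K hK i := by
  have hle : ∀ i : Fin (T.1.maxLevel K + 2), (i : ℕ) ≤ T.1.maxLevel K + 1 := fun i =>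
    Nat.le_of_lt_succ i.2
  let f : Fin (T.1.maxLevel K + 2) → insertionBlock K hK T := fun i =>
    ⟨⟨_, insertLowest_isSearchTree hG hc T (hle i)⟩, i, hle i, rfl⟩
  have hf : Function.Bijective f := by
    constructor
    · intro i j hij
      have h : T.1.insertLowest K hK i = T.1.insertLowest K hK j :=
        congrArg (fun R => R.1.1) hij
      exact Fin.ext (eq_of_insertLowest_eq (hle i) (hle j) h).2
    · rintro ⟨R, i, hi, hR⟩
      exact ⟨⟨i, Nat.lt_succ_of_le hi⟩, Subtype.ext (Subtype.ext hR.symm)⟩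
  refine ⟨⟨Equiv.ofBijective f hf, fun {i j} => ?_⟩, fun i => rfl⟩
  rw [SimpleGraph.pathGraph_adj]
  exact insertLowest_adj_iff (R := (f i).1) (R' := (f j).1) hG hc (hle i) (hle j) rfl rfl

theorem mem_epsilonEdges_of_adj (hG : G.Connected) (hc : G.IsClique (K : Set V))
    {T T' : SearchTree G} (hne : T ≠ T') {R R' : SearchTree (addSimplicial G K)}
    (hR : R ∈ insertionBlock K hK T) (hR' : R' ∈ insertionBlock K hK T')
    (hadj : (rotationGraph (addSimplicial G K)).Adj R R') :
    (rotationGraph G).Adj T T' ∧ s(R, R') ∈ epsilonEdges K hK s(T, T') := by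
  have hT := (isSearchTree_iff hG).1 T.2
  have hT' := (isSearchTree_iff hG).1 T'.2
  obtain ⟨i, hi, hRi⟩ := hR
  obtain ⟨j, hj, hRj⟩ := hR'
  obtain ⟨α, β, h⟩ := (rotationGraph_adj_iff (addSimplicial_connected hG hK)).1 hadj
  rw [hRi, hRj] at h
  rcases h.insertLowest_cases hT hT' hc hi hj with ⟨h', -⟩ | ⟨a, b, rfl, rfl, h'⟩
  · exact absurd (Subtype.ext h') hne
  refine ⟨(rotationGraph_adj_iff hG).2 ⟨a, b, h'⟩, ?_⟩
  -- When a is on the path and b is not, the pair is found in the list of the inverse rotation.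
  by_cases hA : T.1.IsAncestor a (T.1.lowest K hK) → T.1.IsAncestor b (T.1.lowest K hK)
  · exact ⟨T, T', a, b, i, j, R, R', rfl, h'.isRotation hT hT',
      h.epsIndex hc hT hT' hi hj hA, hRi, hRj, rfl⟩
  · push Not at hA
    exact ⟨T', T, b, a, j, i, R', R, Sym2.eq_swap, h'.symm.isRotation hT' hT,
      h.symm.epsIndex hc hT' hT hj hi fun _ =>
        h'.isAncestor_lowest_of_not hK hT hT' hc hA.1 hA.2, hRj, hRi, Sym2.eq_swap⟩

theorem epsilonEdges_eq (hG : G.Connected) (hc : G.IsClique (K : Set V)) {T T' : SearchTree G}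
    (hne : T ≠ T') :
    epsilonEdges K hK s(T, T') =
      {f | ∃ R ∈ insertionBlock K hK T, ∃ R' ∈ insertionBlock K hK T',
        (rotationGraph (addSimplicial G K)).Adj R R' ∧ f = s(R, R')} := by
  ext f
  constructor
  · rintro ⟨T₁, T₂, a, b, i, j, R, R', he, hrot, heps, hR, hR', rfl⟩
    obtain ⟨hi, hj, h⟩ := heps.isFlip hrot.isFlip ((isSearchTree_iff hG).1 T₁.2)
      ((isSearchTree_iff hG).1 T₂.2) hc
    rw [← hR, ← hR'] at h
    have hadj := (rotationGraph_adj_iff (addSimplicial_connected hG hK)).2 ⟨_, _, h⟩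
    rcases Sym2.eq_iff.1 he with ⟨rfl, rfl⟩ | ⟨rfl, rfl⟩
    · exact ⟨R, ⟨i, hi, hR⟩, R', ⟨j, hj, hR'⟩, hadj, rfl⟩
    · exact ⟨R', ⟨j, hj, hR'⟩, R, ⟨i, hi, hR⟩, hadj.symm, Sym2.eq_swap⟩
  · rintro ⟨R, hR, R', hR', hadj, rfl⟩
    exact (mem_epsilonEdges_of_adj hG hc hne hR hR' hadj).2

theorem edgeSet_rotationGraph_addSimplicial (hG : G.Connected) (hc : G.IsClique (K : Set V)) :
    (rotationGraph (addSimplicial G K)).edgeSet =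
      (⋃ T : SearchTree G, blockPathEdges K hK T) ∪
        ⋃ e ∈ (rotationGraph G).edgeSet, epsilonEdges K hK e := by
  ext f
  simp only [Set.mem_union, Set.mem_iUnion]
  constructor
  · induction f with | _ R R'
    intro hadj
    rw [SimpleGraph.mem_edgeSet] at hadj
    obtain ⟨T, hR⟩ := exists_mem_insertionBlock (hK := hK) hG hc R
    obtain ⟨T', hR'⟩ := exists_mem_insertionBlock (hK := hK) hG hc R'
    by_cases hne : T = T'
    · subst hne
      left
      obtain ⟨i, hi, hRi⟩ := hR
      obtain ⟨j, hj, hRj⟩ := hR'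
      rcases (insertLowest_adj_iff hG hc hi hj hRi hRj).1 hadj with rfl | rfl
      · exact ⟨T, i, Nat.le_of_succ_le_succ hj, R, R', hRi, hRj, rfl⟩
      · exact ⟨T, j, Nat.le_of_succ_le_succ hi, R', R, hRj, hRi, Sym2.eq_swap⟩
    · right
      obtain ⟨h1, h2⟩ := mem_epsilonEdges_of_adj hG hc hne hR hR' hadj
      exact ⟨s(T, T'), h1, h2⟩
  · rintro (⟨T, i, hi, R, R', hR, hR', rfl⟩ | ⟨e, he, hf⟩)
    · exact (insertLowest_adj_iff hG hc (Nat.le_succ_of_le hi) (Nat.succ_le_succ hi) hR hR').2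
        (Or.inl rfl)
    · induction e with | _ T T'
      rw [epsilonEdges_eq hG hc ((SimpleGraph.mem_edgeSet _).1 he).ne] at hf
      obtain ⟨R, -, R', -, hadj, rfl⟩ := hf
      exact hadj

end Rotations

theorem mainTheorem8 {V : Type*} [Finite V] (G : SimpleGraph V) (hG : G.Connected)
    (K : Finset V) (hK : K.Nonempty) (hclique : G.IsClique (K : Set V)) :
    -- every `T(i)` is a search tree on `G_K`
    (∀ (T : SearchTree G), ∀ i ≤ T.1.maxLevel K + 1,
      IsSearchTree (addSimplicial G K) (T.1.insertLowest K hK i)) ∧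
    -- the sets `P^x(T)` are pairwise distinct and form a partition of the vertex set of `R(G_K)`
    (Function.Injective fun T : SearchTree G => insertionBlock K hK T) ∧
    Setoid.IsPartition (Set.range fun T : SearchTree G => insertionBlock K hK T) ∧
    -- `P^x(T)` induces the path `T(0), …, T(λ(T) + 1)` in `R(G_K)`
    (∀ T : SearchTree G,
      ∃ φ : SimpleGraph.pathGraph (T.1.maxLevel K + 2) ≃g
          (rotationGraph (addSimplicial G K)).induce (insertionBlock K hK T),
        ∀ i, (φ i).1.1 = T.1.insertLowest K hK i) ∧
    -- `ε^x(TT')` consists of the edges of `R(G_K)` between `P^x(T)` and `P^x(T')`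
    (∀ T T' : SearchTree G, (rotationGraph G).Adj T T' →
      epsilonEdges K hK s(T, T') =
        {f | ∃ R ∈ insertionBlock K hK T, ∃ R' ∈ insertionBlock K hK T',
          (rotationGraph (addSimplicial G K)).Adj R R' ∧ f = s(R, R')}) ∧
    -- the edges of `R(G_K)`
    (rotationGraph (addSimplicial G K)).edgeSet =
      (⋃ T : SearchTree G, blockPathEdges K hK T) ∪
        ⋃ e ∈ (rotationGraph G).edgeSet, epsilonEdges K hK e := by
  refine ⟨fun T i hi => insertLowest_isSearchTree hG hclique T hi, ?_, ⟨?_, ?_⟩,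
    exists_pathGraph_iso hG hclique,
    fun T T' h => epsilonEdges_eq hG hclique h.ne,
    edgeSet_rotationGraph_addSimplicial hG hclique⟩
  · intro T T' h
    obtain ⟨R, hR⟩ := insertionBlock_nonempty (hK := hK) hG hclique T
    have h : insertionBlock K hK T = insertionBlock K hK T' := h
    have hR' : R ∈ insertionBlock K hK T' := h ▸ hR
    exact eq_of_mem_insertionBlock hR hR'
  · rintro ⟨T, hT⟩
    exact (insertionBlock_nonempty hG hclique T).ne_empty hT
  · intro R
    obtain ⟨T, hR⟩ := exists_mem_insertionBlock (hK := hK) hG hclique R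
    refine ⟨_, ⟨⟨T, rfl⟩, hR⟩, ?_⟩
    rintro _ ⟨⟨T', rfl⟩, hR'⟩
    exact congrArg _ (eq_of_mem_insertionBlock hR' hR)
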